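/- Let $sP_2$ denote the disjoint union of $s$ copies of the path $P_2$ on two vertices; a graph is $sP_2$-free if it has no induced subgraph isomorphic to $sP_2$, that is, no induced matching of $s$ edges. For fixed $k$, an instance of List $k$-Colouring is a finite simple graph $G$ together with a list $L(u)\subseteq\{1,\dots,k\}$ for each vertex $u$; the question is whether $G$ has a proper vertex colouring $c$ with $c(u)\in L(u)$ for every vertex $u$. An instance is given to a (multi-tape) Turing machine as a word that lists, for each vertex, its row of the adjacency matrix and the characteristic vector of its list. **Theorem.** For all fixed $k\ge 1$ and $s\ge 1$, List $k$-Colouring restricted to $sP_2$-free graphs is solvable in polynomial time. Moreover, for each fixed $s\ge 1$ this is achieved for all $k\ge1$ by one algorithm with running time $(kn)^{O(k)}$: there are a Turing machine $M_s$ and a constant $C_s$ such that, for every $k\ge 1$ and every instance of List $k$-Colouring whose graph is $sP_2$-free with $n$ vertices, $M_s$ halts with the correct answer within $C_s\,(kn)^{C_s k}+C_s$ steps. -/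

import Mathlib

/-- The disjoint union `rH` of `r` copies of a graph `H`. -/
def disjointCopies {V : Type} (r : ℕ) (H : SimpleGraph V) : SimpleGraph (Fin r × V) where
  Adj x y := x.1 = y.1 ∧ H.Adj x.2 y.2
  symm := ⟨fun _ _ h => ⟨h.1.symm, h.2.symm⟩⟩
  loopless := ⟨fun _ h => H.irrefl h.2⟩

/-- `G` is `sP₂`-free: `G` has no induced subgraph isomorphic to the disjoint union of `s`
copies of the path `P₂` on two vertices. -/
def IsSP2Free {V : Type} (s : ℕ) (G : SimpleGraph V) : Prop :=
  ¬ (disjointCopies s (SimpleGraph.pathGraph 2)).IsIndContained G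

/-- An instance of List `k`-Colouring: a finite graph with vertices numbered `0, …, n - 1`,
together with a `k`-list assignment. The colours `1, …, k` are represented by `Fin k`. -/
structure ListColInstance (k : ℕ) where
  n : ℕ
  G : SimpleGraph (Fin n)
  L : Fin n → Finset (Fin k)

namespace ListColInstance

variable {k : ℕ}

/-- The question of List `k`-Colouring: is there a (proper) colouring that respects the lists? -/
def IsYes (I : ListColInstance k) : Prop :=
  ∃ c : I.G.Coloring (Fin k), ∀ u, c u ∈ I.L u

open Classical in
/-- The correct answer to an instance, as a bit. -/
noncomputable def answer (I : ListColInstance k) : Bool := decide I.IsYes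

open Classical in
/-- The input word of an instance: for each vertex `u` in turn, the block
`bra (row of u in the adjacency matrix) comma (characteristic vector of the list of u) ket`. -/
noncomputable def encode (I : ListColInstance k) : List Computability.Γ' :=
  (List.finRange I.n).flatMap fun u =>
    [Computability.Γ'.bra]
      ++ (List.finRange I.n).map (fun v => Computability.Γ'.bit (decide (I.G.Adj u v)))
      ++ [Computability.Γ'.comma]
      ++ (List.finRange k).map (fun i => Computability.Γ'.bit (decide (i ∈ I.L u)))
      ++ [Computability.Γ'.ket]

end ListColInstance

/-- List `k`-Colouring restricted to `sP₂`-free graphs is solvable in polynomial time: some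
multi-stack Turing machine gives the correct answer on the input word of every instance with an
`sP₂`-free graph, within a number of steps that is polynomial in the length of the input word. -/
def ListColouringPolyTimeOnSP2Free (k s : ℕ) : Prop :=
  Nonempty (Turing.TM2ComputableInPolyTime
    (fun I : {I : ListColInstance k // IsSP2Free s I.G} => I.1.encode)
    Computability.encodeBool
    (fun I => I.1.answer))

/-- The machine `M`, started on the input word of `I`, halts with the correct answer to `I` after
at most `t` steps. -/
def DecidesWithin (M : Turing.TM2ComputableAux Computability.Γ' Bool) {k : ℕ}
    (I : ListColInstance k) (t : ℕ) : Prop :=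
  Nonempty (Turing.TM2OutputsInTime M.tm
    (I.encode.map M.inputAlphabet.invFun)
    (some ((Computability.encodeBool I.answer).map M.outputAlphabet.invFun)) t)

/-! Suppose a list colouring exists, and take one whose sum of colours is least. Then for each `i`
the class of colour `i` is a maximal independent set among the vertices that have `i` in their list
and a colour at least `i`: otherwise some vertex could be recoloured with `i`, lowering the sum.

Without induced matchings of `r + 1` edges, a maximal independent set `J` is encoded by at most `r`
edges (`SimpleGraph.NoInducedMatching.exists_edges`). The greedy procedure in increasing vertex
order recovers `J` unless some vertex `u` outside `J` has its least neighbour `v` in `J` after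
itself. Record such an edge `uv` with `v` largest, and forbid the neighbours of `u` and `v` below
`v`. What remains below `v` has no induced matching of `r` edges, since `uv` would extend it, and
one recurses.

So for `s = r + 1` it suffices to try `n ^ (2 * r * k)` certificates, each giving `r` pairs of
vertices for every colour (`ListColInstance.IsYes.exists_edges`). Whatever the pairs are, the greedy
classes are independent and respect the lists, so a certificate whose classes cover all vertices
proves the answer yes (`ListColInstance.IsGreedy.isYes`).

The search is written as an arithmetic expression `NatExpr.listColouringE`, which reads `n` and `k`
off the input word and stores the greedy decisions as bits in front of it. Expressions compile to
stack programs (`NatExpr.exec`), and these to machines (`StackCmd.Exec.steps`), with explicit step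
counts. The search has cost polynomial in the word length, `n`, `k` and the number of certificates
(`NatExpr.isPoly_searchE`), which yields the bound uniformly in `k`. -/

open Computability (Γ')

/-! ### Stack programs and their compilation to Turing machines -/

/-- Structured programs on stacks numbered by `ℕ`, with one register holding the symbol popped last.
`loop i c` pops stack `i` into the register and runs `c`, until stack `i` is found empty. -/
inductive StackCmd
  | nop
  | pop (i : ℕ)
  | push (i : ℕ) (a : Γ')
  | pushVar (i : ℕ)
  | seq (a b : StackCmd)
  | ite (p : Option Γ' → Bool) (a b : StackCmd)
  | loop (i : ℕ) (c : StackCmd)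

namespace StackCmd

/-- `Exec c s s' t`: the program `c` takes the state `s` to `s'` in at most `t` steps. -/
inductive Exec : StackCmd → Option Γ' × (ℕ → List Γ') → Option Γ' × (ℕ → List Γ') → ℕ → Prop
  | nop (s) : Exec nop s s 1
  | pop (i v S) :
      Exec (pop i) (v, S) ((S i).head?, Function.update S i (S i).tail) 1
  | push (i a v S) : Exec (push i a) (v, S) (v, Function.update S i (a :: S i)) 1
  | pushVar (i v S) :
      Exec (pushVar i) (v, S) (v, Function.update S i (v.getD Γ'.blank :: S i)) 1
  | seq {a b s s' s'' t u} : Exec a s s' t → Exec b s' s'' u → Exec (seq a b) s s'' (t + u)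
  | iteTrue {p : Option Γ' → Bool} {a s s' t} (b) :
      p s.1 = true → Exec a s s' t → Exec (ite p a b) s s' (t + 1)
  | iteFalse {p : Option Γ' → Bool} {b s s' t} (a) :
      p s.1 = false → Exec b s s' t → Exec (ite p a b) s s' (t + 1)
  | loopNil {i c v S} : S i = [] → Exec (loop i c) (v, S) (none, S) 1
  | loopCons {i c v S x l s' s'' t u} : S i = x :: l →
      Exec c (some x, Function.update S i l) s' t → Exec (loop i c) s' s'' u →
      Exec (loop i c) (v, S) s'' (t + u + 1)
  | mono {c s s' t u} : Exec c s s' t → t ≤ u → Exec c s s' u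

/-- The labels of the compiled program. -/
def Label : StackCmd → Type
  | nop | pop _ | push _ _ | pushVar _ => Unit
  | seq a b => Label a ⊕ Label b
  | ite _ a b => Option (Label a ⊕ Label b)
  | loop _ c => Option (Label c)

/-- There are finitely many labels. -/
instance labelFintype : (c : StackCmd) → Fintype (Label c)
  | nop | pop _ | push _ _ | pushVar _ => inferInstanceAs (Fintype Unit)
  | seq a b =>
      letI := labelFintype a
      letI := labelFintype b
      inferInstanceAs (Fintype (Label a ⊕ Label b))
  | ite _ a b =>
      letI := labelFintype a
      letI := labelFintype b
      inferInstanceAs (Fintype (Option (Label a ⊕ Label b)))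
  | loop _ c =>
      letI := labelFintype c
      inferInstanceAs (Fintype (Option (Label c)))

/-- The label at which the compiled program is entered. -/
def entry : (c : StackCmd) → Label c
  | nop | pop _ | push _ _ | pushVar _ => ()
  | seq a _ => Sum.inl (entry a)
  | ite _ _ _ => none
  | loop _ _ => none

/-- All stacks the program uses have a number at most `bound`. -/
def bound : StackCmd → ℕ
  | nop => 0
  | pop i | push i _ | pushVar i => i
  | seq a b => max (bound a) (bound b)
  | ite _ a b => max (bound a) (bound b)
  | loop i c => max i (bound c)

/-- The alphabets of a machine with stacks `0, …, M` over `Γ'` and an output stack over `Bool`. -/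
abbrev Alphabet (M : ℕ) : Option (Fin (M + 1)) → Type
  | none => Bool
  | some _ => Γ'

/-- Stack number `i` of the machine. -/
abbrev ix (M i : ℕ) : Option (Fin (M + 1)) := some (Fin.ofNat (M + 1) i)

/-- The compiled program, with labels embedded by `emb` and continuing at `exit`. -/
def code (M : ℕ) {Λ : Type} : (c : StackCmd) → (Label c → Λ) → Λ → Label c →
    Turing.TM2.Stmt (Alphabet M) Λ (Option Γ')
  | nop, _, exit, _ => .goto fun _ => exit
  | pop i, _, exit, _ => .pop (ix M i) (fun _ a => a) (.goto fun _ => exit)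
  | push i a, _, exit, _ => .push (ix M i) (fun _ => a) (.goto fun _ => exit)
  | pushVar i, _, exit, _ =>
      .push (ix M i) (fun v => v.getD Γ'.blank) (.goto fun _ => exit)
  | seq a b, emb, exit, l =>
      match l with
      | Sum.inl l => code M a (fun l => emb (Sum.inl l)) (emb (Sum.inr (entry b))) l
      | Sum.inr l => code M b (fun l => emb (Sum.inr l)) exit l
  | ite p a b, emb, exit, l =>
      match l with
      | none => .branch p (.goto fun _ => emb (some (Sum.inl (entry a))))
          (.goto fun _ => emb (some (Sum.inr (entry b))))
      | some (Sum.inl l) => code M a (fun l => emb (some (Sum.inl l))) exit l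
      | some (Sum.inr l) => code M b (fun l => emb (some (Sum.inr l))) exit l
  | loop i c, emb, exit, l =>
      match l with
      | none => .pop (ix M i) (fun _ a => a)
          (.branch Option.isSome (.goto fun _ => emb (some (entry c))) (.goto fun _ => exit))
      | some l => code M c (fun l => emb (some l)) (emb none) l

/-- The stacks of the machine, given the stacks of the program. -/
def toStacks (M : ℕ) (S : ℕ → List Γ') : (k : Option (Fin (M + 1))) → List (Alphabet M k)
  | none => []
  | some i => S i

theorem toStacks_ix {M i : ℕ} (h : i ≤ M) (S : ℕ → List Γ') : toStacks M S (ix M i) = S i := by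
  change S (i % (M + 1)) = S i
  rw [Nat.mod_eq_of_lt (by omega)]

theorem toStacks_update {M i : ℕ} (h : i ≤ M) (S : ℕ → List Γ') (l : List Γ') :
    toStacks M (Function.update S i l) = Function.update (toStacks M S) (ix M i) l := by
  funext k
  cases k with
  | none => rfl
  | some j =>
    have hi : (Fin.ofNat (M + 1) i).val = i := Nat.mod_eq_of_lt (by omega)
    by_cases hj : j = Fin.ofNat (M + 1) i
    · subst hj
      have := Function.update_self (ix M i) l (toStacks M S)
      refine Eq.trans ?_ this.symm
      change Function.update S i l (Fin.ofNat (M + 1) i).val = l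
      rw [hi, Function.update_self]
    · have hne : (some j : Option (Fin (M + 1))) ≠ ix M i := fun h => hj (Option.some.inj h)
      rw [Function.update_of_ne hne]
      change Function.update S i l j.val = S j.val
      rw [Function.update_of_ne]
      intro h'
      exact hj (Fin.ext (by rw [hi, h']))

/-- The machine configuration at label `l` for a state of the program. -/
def cfg (M : ℕ) {Λ : Type} (l : Λ) (s : Option Γ' × (ℕ → List Γ')) :
    Turing.TM2.Cfg (Alphabet M) Λ (Option Γ') :=
  ⟨some l, s.1, toStacks M s.2⟩

/-- `n` iterated steps of a machine. -/
def steps {M : ℕ} {Λ : Type} (m : Λ → Turing.TM2.Stmt (Alphabet M) Λ (Option Γ')) (n : ℕ)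
    (a : Option (Turing.TM2.Cfg (Alphabet M) Λ (Option Γ'))) :
    Option (Turing.TM2.Cfg (Alphabet M) Λ (Option Γ')) :=
  (flip bind (Turing.TM2.step m))^[n] a

theorem steps_one {M : ℕ} {Λ : Type} (m : Λ → Turing.TM2.Stmt (Alphabet M) Λ (Option Γ'))
    (l : Λ) (s : Option Γ' × (ℕ → List Γ')) :
    steps m 1 (some (cfg M l s)) = some (Turing.TM2.stepAux (m l) s.1 (toStacks M s.2)) := rfl

theorem steps_trans {M : ℕ} {Λ : Type} {m : Λ → Turing.TM2.Stmt (Alphabet M) Λ (Option Γ')}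
    {a b c : Option (Turing.TM2.Cfg (Alphabet M) Λ (Option Γ'))} {t u : ℕ}
    (h : ∃ n ≤ t, steps m n a = b) (h' : ∃ n ≤ u, steps m n b = c) :
    ∃ n ≤ t + u, steps m n a = c := by
  obtain ⟨n, hn, rfl⟩ := h
  obtain ⟨n', hn', rfl⟩ := h'
  exact ⟨n' + n, by omega, Function.iterate_add_apply _ _ _ _⟩

/-- Induction on the execution. A subprogram occupies part of the labels, so its embedding is a
restriction of `emb`. Only its exit changes: the entry of the second part for `seq`, the head of the
loop for a loop body. -/
theorem Exec.steps {M : ℕ} {c : StackCmd} {s s' : Option Γ' × (ℕ → List Γ')} {t : ℕ}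
    (h : Exec c s s' t) (hc : c.bound ≤ M) {Λ : Type}
    {m : Λ → Turing.TM2.Stmt (Alphabet M) Λ (Option Γ')} {emb : Label c → Λ} {exit : Λ}
    (hm : ∀ l, m (emb l) = code M c emb exit l) :
    ∃ n ≤ t, steps m n (some (cfg M (emb (entry c)) s)) = some (cfg M exit s') := by
  induction h generalizing exit with
  | nop s =>
    refine ⟨1, le_rfl, ?_⟩
    rw [steps_one, hm]; rfl
  | pop i v S =>
    refine ⟨1, le_rfl, ?_⟩
    rw [steps_one, hm]
    simp only [code, Turing.TM2.stepAux, cfg]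
    have hi : i ≤ M := hc
    rw [toStacks_ix hi, toStacks_update hi]
  | push i a v S =>
    refine ⟨1, le_rfl, ?_⟩
    rw [steps_one, hm]
    simp only [code, Turing.TM2.stepAux, cfg]
    have hi : i ≤ M := hc
    rw [toStacks_ix hi, toStacks_update hi]
  | pushVar i v S =>
    refine ⟨1, le_rfl, ?_⟩
    rw [steps_one, hm]
    simp only [code, Turing.TM2.stepAux, cfg]
    have hi : i ≤ M := hc
    rw [toStacks_ix hi, toStacks_update hi]
  | @seq a b s s' s'' t u _ _ iha ihb =>
    have hc' : max a.bound b.bound ≤ M := hc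
    exact steps_trans
      (iha (emb := fun l => emb (Sum.inl l)) (exit := emb (Sum.inr (entry b)))
        (by omega) (fun l => hm (Sum.inl l)))
      (ihb (emb := fun l => emb (Sum.inr l)) (by omega) (fun l => hm (Sum.inr l)))
  | @iteTrue p a s s' t b hp _ ih =>
    have hc' : max a.bound b.bound ≤ M := hc
    rw [Nat.add_comm]
    refine steps_trans ⟨1, le_rfl, ?_⟩
      (ih (emb := fun l => emb (some (Sum.inl l))) (by omega) (fun l => hm (some (Sum.inl l))))
    rw [steps_one, hm]
    change some (Turing.TM2.stepAux (.branch p _ _) _ _) = _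
    simp only [Turing.TM2.stepAux, hp]; rfl
  | @iteFalse p b s s' t a hp _ ih =>
    have hc' : max a.bound b.bound ≤ M := hc
    rw [Nat.add_comm]
    refine steps_trans ⟨1, le_rfl, ?_⟩
      (ih (emb := fun l => emb (some (Sum.inr l))) (by omega) (fun l => hm (some (Sum.inr l))))
    rw [steps_one, hm]
    change some (Turing.TM2.stepAux (.branch p _ _) _ _) = _
    simp only [Turing.TM2.stepAux, hp]; rfl
  | @loopNil i c v S h =>
    have hc' : max i c.bound ≤ M := hc
    refine ⟨1, le_rfl, ?_⟩
    rw [steps_one, hm]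
    change some (Turing.TM2.stepAux (.pop (ix M i) _ (.branch _ _ _)) _ _) = _
    have hi : i ≤ M := by omega
    simp only [Turing.TM2.stepAux, cfg]
    rw [toStacks_ix hi, h]
    have : Function.update (toStacks M S) (ix M i) ([] : List Γ') = toStacks M S := by
      rw [← toStacks_update hi, ← h, Function.update_eq_self]
    exact congrArg some (congrArg (fun x => (⟨some exit, none, x⟩ : Turing.TM2.Cfg _ _ _)) this)
  | @loopCons i c v S x l s' s'' t u h _ _ ih ih' =>
    have hc' : max i c.bound ≤ M := hc
    rw [Nat.add_comm, ← Nat.add_assoc]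
    refine steps_trans (steps_trans ⟨1, le_rfl, ?_⟩
      (ih (emb := fun l => emb (some l)) (exit := emb none) (by omega)
        (fun l => hm (some l)))) (ih' hc hm)
    rw [steps_one, hm]
    change some (Turing.TM2.stepAux (.pop (ix M i) _ (.branch _ _ _)) _ _) = _
    have hi : i ≤ M := by omega
    simp only [Turing.TM2.stepAux, cfg]
    rw [toStacks_ix hi, h, toStacks_update hi]; rfl
  | mono _ h ih =>
    obtain ⟨n, hn, h'⟩ := ih hc hm
    exact ⟨n, hn.trans h, h'⟩

/-- The machine that runs `c` on the stacks, with the input on stack `0`, and then outputs whether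
the register is occupied. -/
def machine (c : StackCmd) : Turing.TM2ComputableAux Γ' Bool where
  tm :=
    { K := Option (Fin (c.bound + 1))
      k₀ := some 0
      k₁ := none
      Γ := Alphabet c.bound
      Λ := Option (Label c)
      main := some (entry c)
      ΛFin := letI := labelFintype c; inferInstanceAs (Fintype (Option (Label c)))
      σ := Option Γ'
      initialState := none
      Γk₀Fin := inferInstanceAs (Fintype Γ')
      m := fun l => match l with
        | some l => code c.bound c some none l
        | none => .push none (fun v : Option Γ' => v.isSome) (.load (fun _ => none) .halt) }
  inputAlphabet := Equiv.refl Γ'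
  outputAlphabet := Equiv.refl Bool

/-- The final label takes one further step: it pushes the answer, clears the register and halts. A
halting configuration must have all other stacks empty, so the program has to clean up after itself.
-/
theorem machine_outputs {c : StackCmd} {w : List Γ'} {b : Option Γ'} {t : ℕ}
    (h : Exec c (none, Function.update (fun _ => []) 0 w) (b, fun _ => []) t) :
    Nonempty (Turing.TM2OutputsInTime (machine c).tm (w.map (machine c).inputAlphabet.invFun)
      (some ((Computability.encodeBool b.isSome).map (machine c).outputAlphabet.invFun))
      (t + 1)) := by
  obtain ⟨n, hn, hs⟩ := steps_trans (h.steps le_rfl (m := (machine c).tm.m) (emb := some)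
    (exit := none) (fun l => rfl)) ⟨1, le_rfl, rfl⟩
  refine ⟨⟨⟨n, ?_⟩, hn⟩⟩
  have h1 : Turing.initList (machine c).tm (w.map (machine c).inputAlphabet.invFun) =
      cfg c.bound (some (entry c)) (none, Function.update (fun _ => []) 0 w) := by
    have hw : w.map (machine c).inputAlphabet.invFun = w := List.map_id w
    rw [hw]
    unfold Turing.initList cfg
    congr 1
    funext k
    cases k with
    | none => rfl
    | some j =>
      by_cases hj : j = 0
      · subst hj; rfl
      · have : (some j : Option (Fin (c.bound + 1))) ≠ some 0 := fun h => hj (Option.some.inj h)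
        have h2 : toStacks c.bound (Function.update (fun _ => []) 0 w) (some j) = [] := by
          change Function.update (fun _ => []) 0 w j.val = []
          rw [Function.update_of_ne]
          exact fun h => hj (Fin.ext h)
        rw [h2]
        exact dif_neg this
  have h2 : some ((Computability.encodeBool b.isSome).map (machine c).outputAlphabet.invFun) =
      some [b.isSome] := rfl
  rw [h1, h2]
  refine Eq.trans hs ?_
  change some _ = some _
  congr 1
  change Turing.TM2.stepAux (Γ := Alphabet c.bound) (.push none (fun v : Option Γ' => v.isSome)
    (.load (fun _ => none) .halt)) _ _ = _
  simp only [Turing.TM2.stepAux]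
  unfold Turing.haltList
  congr 1
  funext k
  cases k with
  | none => rfl
  | some j => rfl

end StackCmd

/-! ### Arithmetic expressions and their compilation -/

/-- `recVal a f n` is `n`-fold recursion from `a` with step `f`. -/
def recVal {α : Type} (a : α) (f : ℕ → α → α) : ℕ → α
  | 0 => a
  | n + 1 => f n (recVal a f n)

/-- Expressions denoting natural numbers. They depend on an environment (variables are de Bruijn
indices) and on a word, to which `build` prepends bits. -/
inductive NatExpr
  | var (i : ℕ)
  | zero
  | succ (e : NatExpr)
  | pred (e : NatExpr)
  /-- `e` with the `j`-th entry of the environment removed -/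
  | del (j : ℕ) (e : NatExpr)
  /-- recursion of length `n` from `a`; in the step `b`, variable `0` is the counter and variable
  `1` the current value -/
  | fold (n a b : NatExpr)
  /-- whether the symbol at position `e` of the word is `s` -/
  | read (s : Γ') (e : NatExpr)
  | len
  /-- `n` times prepends to the word the truth value of `b`, in which variable `0` is the counter;
  the value is that of `c` for the resulting word -/
  | build (n b c : NatExpr)

namespace NatExpr

/-- The value of an expression. -/
def eval : NatExpr → List ℕ → List Γ' → ℕ
  | var i, env, _ => env.getD i 0
  | zero, _, _ => 0
  | succ e, env, T => eval e env T + 1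
  | pred e, env, T => eval e env T - 1
  | del j e, env, T => eval e (env.eraseIdx j) T
  | fold n a b, env, T =>
      recVal (eval a env T) (fun x acc => eval b (x :: acc :: env) T) (eval n env T)
  | read s e, env, T => if T[eval e env T]? = some s then 1 else 0
  | len, _, T => T.length
  | build n b c, env, T =>
      eval c env (recVal T (fun x H => Γ'.bit (decide (eval b (x :: env) H ≠ 0)) :: H)
        (eval n env T))

/-- The running time of the compiled expression. -/
def cost : NatExpr → List ℕ → List Γ' → ℕ
  | var i, env, _ => 5 * env.getD i 0 + 2
  | zero, _, _ => 1
  | succ e, env, T => cost e env T + 1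
  | pred e, env, T => cost e env T + 1
  | del j e, env, T => cost e (env.eraseIdx j) T
  | fold n a b, env, T =>
      cost a env T + cost n env T +
      ∑ x ∈ Finset.range (eval n env T),
        (cost b (x :: recVal (eval a env T) (fun x acc => eval b (x :: acc :: env) T) x :: env) T +
          2 * recVal (eval a env T) (fun x acc => eval b (x :: acc :: env) T) x +
          2 * recVal (eval a env T) (fun x acc => eval b (x :: acc :: env) T) (x + 1) + 4) +
      2 * eval n env T + 2
  | read _ e, env, T => cost e env T + 6 * eval e env T + 8
  | len, _, T => 5 * T.length + 2
  | build n b c, env, T =>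
      cost n env T +
      ∑ x ∈ Finset.range (eval n env T),
        (cost b (x :: env) (recVal T (fun x H => Γ'.bit (decide (eval b (x :: env) H ≠ 0)) :: H) x) +
          2 * eval b (x :: env)
            (recVal T (fun x H => Γ'.bit (decide (eval b (x :: env) H ≠ 0)) :: H) x) + 6) +
      cost c env (recVal T (fun x H => Γ'.bit (decide (eval b (x :: env) H ≠ 0)) :: H)
        (eval n env T)) +
      2 * eval n env T +
      2 * eval c env (recVal T (fun x H => Γ'.bit (decide (eval b (x :: env) H ≠ 0)) :: H)
        (eval n env T)) + 4

open StackCmd in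
/-- Compilation: variable `i` is on stack `ρ[i]`, stacks from `d` on are free, and the value is
left on stack `d`. The word is on stack `0`; stack `1` is auxiliary. -/
def comp : NatExpr → List ℕ → ℕ → StackCmd
  | var i, ρ, d =>
      match ρ[i]? with
      | none => .nop
      | some r =>
          .seq (.loop r (.seq (.push d .blank) (.push (d + 1) .blank)))
            (.loop (d + 1) (.push r .blank))
  | zero, _, _ => .nop
  | succ e, ρ, d => .seq (comp e ρ d) (.push d .blank)
  | pred e, ρ, d => .seq (comp e ρ d) (.pop d)
  | del j e, ρ, d => comp e (ρ.eraseIdx j) d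
  | fold n a b, ρ, d =>
      .seq (.seq (.seq (comp a ρ d) (comp n ρ (d + 2)))
        (.loop (d + 2)
          (.seq (.seq (.seq (comp b ((d + 1) :: d :: ρ) (d + 3)) (.loop d .nop))
            (.loop (d + 3) (.push d .blank))) (.push (d + 1) .blank))))
        (.loop (d + 1) .nop)
  | read s e, ρ, d =>
      .seq (.seq (.seq (comp e ρ d)
        (.loop d (.seq (.pop 0) (.ite Option.isSome (.pushVar 1) .nop))))
        (.seq (.pop 0)
          (.ite Option.isSome (.seq (.pushVar 0) (.ite (· == some s) (.push d .blank) .nop)) .nop)))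
        (.loop 1 (.pushVar 0))
  | len, _, d =>
      .seq (.loop 0 (.seq (.pushVar 1) (.push d .blank))) (.loop 1 (.pushVar 0))
  | build n b c, ρ, d =>
      .seq (.seq (.seq (.seq (comp n ρ (d + 1))
        (.loop (d + 1)
          (.seq (.seq (.seq (.seq (comp b (d :: ρ) (d + 2)) (.pop (d + 2)))
            (.ite Option.isSome (.push 0 (.bit true)) (.push 0 (.bit false))))
            (.loop (d + 2) .nop)) (.push d .blank))))
        (comp c ρ (d + 1))) (.loop d (.pop 0))) (.loop (d + 1) (.push d .blank))

/-- The stacks `S` represent the environment and the word. -/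
structure Represents (ρ : List ℕ) (d : ℕ) (env : List ℕ) (T : List Γ') (S : ℕ → List Γ') :
    Prop where
  two_le : 2 ≤ d
  word : S 0 = T
  aux : S 1 = []
  free : ∀ j, d ≤ j → S j = []
  vars : List.Forall₂ (fun r v => 2 ≤ r ∧ r < d ∧ S r = List.replicate v Γ'.blank) ρ env

end NatExpr

/-! ### Loops, and correctness of compiled expressions -/

namespace StackCmd

theorem Exec.cast {c : StackCmd} {s : Option Γ' × (ℕ → List Γ')} {v : Option Γ'}
    {S S' : ℕ → List Γ'} {t : ℕ} (h : Exec c s (v, S) t) (e : S = S') : Exec c s (v, S') t :=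
  e ▸ h

/-- Induction on the number `m` of rounds that are left. -/
theorem Exec.loop_list_aux {i : ℕ} {c : StackCmd} {l : List Γ'} {F : ℕ → ℕ → List Γ'} {τ : ℕ → ℕ}
    (hF : ∀ j ≤ l.length, F j i = l.drop j)
    (h : ∀ j (hj : j < l.length), ∃ v',
      Exec c (some l[j], Function.update (F j) i (l.drop (j + 1))) (v', F (j + 1)) (τ j))
    (m : ℕ) : ∀ j, j + m = l.length → ∀ v,
      Exec (loop i c) (v, F j) (none, F l.length) (∑ x ∈ Finset.range m, (τ (j + x) + 1) + 1) := by
  induction m with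
  | zero =>
    intro j hj v
    obtain rfl : j = l.length := by omega
    exact (Exec.loopNil (by rw [hF _ le_rfl, List.drop_length])).mono (by simp)
  | succ m ih =>
    intro j hj v
    have hj' : j < l.length := by omega
    obtain ⟨v', h'⟩ := h j hj'
    refine (Exec.loopCons (by rw [hF _ hj'.le, List.drop_eq_getElem_cons hj']) h'
      (ih (j + 1) (by omega) v')).mono ?_
    rw [Finset.sum_range_succ']
    simp only [Nat.add_zero, Nat.add_assoc, Nat.add_comm 1]
    omega

/-- Running a loop: `F j` are the stacks after `j` rounds. -/
theorem Exec.loop_list {i : ℕ} {c : StackCmd} (l : List Γ') (F : ℕ → ℕ → List Γ') (τ : ℕ → ℕ)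
    (hF : ∀ j ≤ l.length, F j i = l.drop j)
    (h : ∀ j (hj : j < l.length), ∃ v',
      Exec c (some l[j], Function.update (F j) i (l.drop (j + 1))) (v', F (j + 1)) (τ j)) (v) :
    Exec (loop i c) (v, F 0) (none, F l.length)
      (∑ x ∈ Finset.range l.length, (τ x + 1) + 1) := by
  simpa using Exec.loop_list_aux hF h l.length 0 (by omega) v

/-- Running a counting loop: `F j` are the stacks after `j` rounds. -/
theorem Exec.loop_replicate {i : ℕ} {c : StackCmd} (n : ℕ) (F : ℕ → ℕ → List Γ') (τ : ℕ → ℕ)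
    (hF : ∀ j ≤ n, F j i = List.replicate (n - j) Γ'.blank)
    (h : ∀ j < n, ∃ v', Exec c
      (some Γ'.blank, Function.update (F j) i (List.replicate (n - j - 1) Γ'.blank))
      (v', F (j + 1)) (τ j)) (v) :
    Exec (loop i c) (v, F 0) (none, F n) (∑ x ∈ Finset.range n, (τ x + 1) + 1) := by
  have := Exec.loop_list (i := i) (c := c) (List.replicate n Γ'.blank) F τ
    (by intro j hj; rw [List.drop_replicate]; exact hF j (by simpa using hj))
    (by
      intro j hj
      have hj' : j < n := by simpa using hj
      rw [List.drop_replicate, List.getElem_replicate, ← Nat.sub_sub]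
      exact h j hj') v
  simpa using this

theorem Exec.clear (i n : ℕ) (v S) (h : S i = List.replicate n Γ'.blank) :
    Exec (loop i StackCmd.nop) (v, S) (none, Function.update S i []) (2 * n + 1) := by
  have := Exec.loop_replicate (i := i) (c := StackCmd.nop) n
    (fun j => Function.update S i (List.replicate (n - j) Γ'.blank)) (fun _ => 1)
    (by intro j _; simp)
    (by
      intro j hj
      exact ⟨_, (Exec.nop _).cast (by simp [Nat.sub_sub])⟩) v
  refine ((by simpa [← h] using this : Exec _ _ _ _)).mono ?_
  omega

theorem Exec.move {i j : ℕ} (hij : i ≠ j) (n : ℕ) (v S) (h : S i = List.replicate n Γ'.blank)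
    (h' : S j = []) :
    Exec (loop i (StackCmd.push j Γ'.blank)) (v, S)
      (none, Function.update (Function.update S i []) j (List.replicate n Γ'.blank)) (2 * n + 1) := by
  have := Exec.loop_replicate (i := i) (c := StackCmd.push j Γ'.blank) n
    (fun x => Function.update (Function.update S i (List.replicate (n - x) Γ'.blank)) j
      (List.replicate x Γ'.blank)) (fun _ => 1)
    (by intro x _; simp [hij])
    (by
      intro x hx
      refine ⟨_, (Exec.push ..).cast ?_⟩
      funext k
      by_cases hk : k = j
      · subst hk; simp [hij.symm, List.replicate_succ]
      · by_cases hk' : k = i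
        · subst hk'; simp [hij, Nat.sub_sub]
        · simp [hk, hk']) v
  have e : (fun x => Function.update (Function.update S i (List.replicate (n - x) Γ'.blank)) j
      (List.replicate x Γ'.blank)) 0 = S := by
    simp only [Nat.sub_zero, List.replicate_zero, ← h, ← h', Function.update_eq_self]
  simp only [] at e
  rw [e] at this
  refine (this.cast (by simp)).mono ?_
  simp; omega

end StackCmd

namespace NatExpr
open StackCmd

/-- Variables live on stacks `2, …, d - 1`, so only these must stay the same when the word or the
first free stack changes. -/
theorem Represents.change {ρ env : List ℕ} {d d' : ℕ} {T T' : List Γ'} {S S' : ℕ → List Γ'}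
    (h : Represents ρ d env T S) (hd : d ≤ d') (h0 : S' 0 = T') (h1 : S' 1 = [])
    (hf : ∀ j, d' ≤ j → S' j = []) (hv : ∀ j, 2 ≤ j → j < d → S' j = S j) :
    Represents ρ d' env T' S' where
  two_le := h.two_le.trans hd
  word := h0
  aux := h1
  free := hf
  vars := h.vars.imp fun r _ ⟨h2, hr, hS⟩ => ⟨h2, hr.trans_le hd, (hv r h2 hr).trans hS⟩

theorem Represents.cons {ρ env : List ℕ} {d r v : ℕ} {T : List Γ'} {S : ℕ → List Γ'}
    (h : Represents ρ d env T S) (h2 : 2 ≤ r) (hr : r < d)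
    (hS : S r = List.replicate v Γ'.blank) : Represents (r :: ρ) d (v :: env) T S :=
  { h with vars := .cons ⟨h2, hr, hS⟩ h.vars }

theorem _root_.List.Forall₂.eraseIdx {α β : Type} {R : α → β → Prop} {l : List α} {l' : List β}
    (h : List.Forall₂ R l l') (j : ℕ) : List.Forall₂ R (l.eraseIdx j) (l'.eraseIdx j) := by
  induction h generalizing j with
  | nil => simp
  | cons h _ ih =>
    cases j with
    | zero => simpa
    | succ j => simpa using ⟨h, ih j⟩

/-- Reading a stack empties it. The variable is therefore moved to both `d` and `d + 1`, and the
second copy is moved back. -/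
theorem exec_var (i : ℕ) {ρ env : List ℕ} {d : ℕ} {T : List Γ'} {S : ℕ → List Γ'}
    (h : Represents ρ d env T S) (v) : ∃ v', Exec (comp (var i) ρ d) (v, S)
      (v', Function.update S d (List.replicate (eval (var i) env T) Γ'.blank))
      (cost (var i) env T) := by
  have hlen := h.vars.length_eq
  have hd := h.free d le_rfl
  have hd1 := h.free (d + 1) (by omega)
  rcases lt_or_ge i ρ.length with hi | hi
  · obtain ⟨h2, hr, hS⟩ := h.vars.get hi (hlen ▸ hi)
    simp only [List.get_eq_getElem] at h2 hr hS
    have e1 : comp (var i) ρ d =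
        .seq (.loop ρ[i] (.seq (.push d .blank) (.push (d + 1) .blank)))
            (.loop (d + 1) (.push ρ[i] .blank)) := by
      simp [comp, hi]
    have e2 : env.getD i 0 = env[i] := by simp [List.getD, hlen ▸ hi]
    simp only [eval, cost, e2]
    rw [e1]
    generalize ρ[i] = r at *
    generalize env[i]'(hlen ▸ hi) = n at *
    have L1 := Exec.loop_replicate (i := r)
      (c := .seq (.push d Γ'.blank) (.push (d + 1) Γ'.blank)) n
      (fun j => Function.update (Function.update (Function.update S r
        (List.replicate (n - j) Γ'.blank)) d (List.replicate j Γ'.blank)) (d + 1)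
        (List.replicate j Γ'.blank)) (fun _ => 2)
      (by intro j _; simp [Function.update_apply]; grind)
      (by
        intro j hj
        refine ⟨_, (Exec.seq (.push ..) (.push ..)).cast ?_⟩
        funext k
        simp only [Function.update_apply]
        grind) v
    have L2 := Exec.move (i := d + 1) (j := r) (by omega) n none
      (Function.update (Function.update (Function.update S r
        (List.replicate (n - n) Γ'.blank)) d (List.replicate n Γ'.blank)) (d + 1)
        (List.replicate n Γ'.blank)) (by simp)
      (by simp [Function.update_apply]; grind)
    have e0 : (fun j => Function.update (Function.update (Function.update S r
        (List.replicate (n - j) Γ'.blank)) d (List.replicate j Γ'.blank)) (d + 1)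
        (List.replicate j Γ'.blank)) 0 = S := by
      funext k
      simp only [Function.update_apply]
      grind
    simp only [] at e0
    rw [e0] at L1
    refine ⟨_, ((L1.seq L2).cast ?_).mono ?_⟩
    · funext k
      simp only [Function.update_apply]
      grind
    · simp; omega
  · have e1 : comp (var i) ρ d = .nop := by simp [comp, hi]
    have e2 : env.getD i 0 = 0 := by simp [List.getD, hlen ▸ hi]
    rw [e1]
    simp only [eval, cost, e2]
    refine ⟨v, ((Exec.nop _).cast ?_).mono (by omega)⟩
    simp [← hd]

/-- Stack `d` holds the current value, `d + 1` the counter, `d + 2` the rounds left, and `d + 3`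
receives the value of the step before it replaces the one on `d`. -/
theorem exec_fold {n a b : NatExpr} {ρ env : List ℕ} {d : ℕ} {T : List Γ'} {S : ℕ → List Γ'}
    (ihn : ∀ {ρ env d S}, Represents ρ d env T S → ∀ v, ∃ v', Exec (comp n ρ d) (v, S)
      (v', Function.update S d (List.replicate (eval n env T) Γ'.blank)) (cost n env T))
    (iha : ∀ {ρ env d S}, Represents ρ d env T S → ∀ v, ∃ v', Exec (comp a ρ d) (v, S)
      (v', Function.update S d (List.replicate (eval a env T) Γ'.blank)) (cost a env T))
    (ihb : ∀ {ρ env d S}, Represents ρ d env T S → ∀ v, ∃ v', Exec (comp b ρ d) (v, S)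
      (v', Function.update S d (List.replicate (eval b env T) Γ'.blank)) (cost b env T))
    (h : Represents ρ d env T S) (v) : ∃ v', Exec (comp (fold n a b) ρ d) (v, S)
      (v', Function.update S d (List.replicate (eval (fold n a b) env T) Γ'.blank))
      (cost (fold n a b) env T) := by
  have hd2 := h.two_le
  have hf := h.free
  have h0 := h.word
  have h1 := h.aux
  simp only [eval, cost, comp]
  obtain ⟨v1, E1⟩ := iha h v
  have h' : Represents ρ (d + 2) env T
      (Function.update S d (List.replicate (eval a env T) Γ'.blank)) :=
    h.change (by omega) (by grind [Function.update_apply]) (by grind [Function.update_apply])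
      (by grind [Function.update_apply]) (by grind [Function.update_apply])
  obtain ⟨v2, E2⟩ := ihn h' v1
  generalize hN : eval n env T = N at *
  set A : ℕ → ℕ := recVal (eval a env T) (fun x acc => eval b (x :: acc :: env) T) with hA
  have hA0 : A 0 = eval a env T := rfl
  have hA1 : ∀ x, A (x + 1) = eval b (x :: A x :: env) T := fun x => rfl
  rw [← hA0] at E2
  clear_value A
  have L1 := Exec.loop_replicate (i := d + 2)
    (c := .seq (.seq (.seq (comp b ((d + 1) :: d :: ρ) (d + 3)) (.loop d .nop))
            (.loop (d + 3) (.push d .blank))) (.push (d + 1) .blank)) N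
    (fun j => Function.update (Function.update (Function.update S d
      (List.replicate (A j) Γ'.blank)) (d + 1) (List.replicate j Γ'.blank)) (d + 2)
      (List.replicate (N - j) Γ'.blank))
    (fun x => cost b (x :: A x :: env) T + 2 * A x + 2 * A (x + 1) + 3)
    (by intro j _; simp)
    (by
      intro j hj
      set G := Function.update (Function.update (Function.update (Function.update S d
        (List.replicate (A j) Γ'.blank)) (d + 1) (List.replicate j Γ'.blank)) (d + 2)
        (List.replicate (N - j) Γ'.blank)) (d + 2) (List.replicate (N - j - 1) Γ'.blank) with hG
      have hGr : Represents ((d + 1) :: d :: ρ) (d + 3) (j :: A j :: env) T G := by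
        refine ((h.change (by omega) ?_ ?_ ?_ ?_).cons ?_ ?_ ?_).cons ?_ ?_ ?_ <;>
          grind [Function.update_apply]
      obtain ⟨w, X1⟩ := ihb hGr (some Γ'.blank)
      rw [← hA1] at X1
      have X2 := Exec.clear d (A j) w
        (Function.update G (d + 3) (List.replicate (A (j + 1)) Γ'.blank))
        (by grind [Function.update_apply])
      have X3 := Exec.move (i := d + 3) (j := d) (by omega) (A (j + 1)) none
        (Function.update (Function.update G (d + 3) (List.replicate (A (j + 1)) Γ'.blank)) d [])
        (by grind [Function.update_apply]) (by grind [Function.update_apply])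
      refine ⟨_, ((((X1.seq X2).seq X3).seq (.push ..)).cast ?_).mono ?_⟩
      · funext k
        simp only [hG, Function.update_apply]
        grind
      · omega) v2
  have e0 : (fun j => Function.update (Function.update (Function.update S d
      (List.replicate (A j) Γ'.blank)) (d + 1) (List.replicate j Γ'.blank)) (d + 2)
      (List.replicate (N - j) Γ'.blank)) 0 =
      Function.update (Function.update S d (List.replicate (A 0) Γ'.blank)) (d + 2)
        (List.replicate N Γ'.blank) := by
    funext k
    simp only [Function.update_apply]
    grind
  simp only [] at e0
  rw [e0] at L1
  rw [← hA0] at E1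
  have L2 := Exec.clear (d + 1) N none
    (Function.update (Function.update (Function.update S d
      (List.replicate (A N) Γ'.blank)) (d + 1) (List.replicate N Γ'.blank)) (d + 2)
      (List.replicate (N - N) Γ'.blank)) (by grind [Function.update_apply])
  refine ⟨_, ((((E1.seq E2).seq L1).seq L2).cast ?_).mono ?_⟩
  · funext k
    simp only [Function.update_apply]
    grind
  · simp only [Nat.add_assoc, Nat.reduceAdd]
    omega

end NatExpr

namespace NatExpr
open StackCmd

theorem exec_restore (l : List Γ') (v : Option Γ') {S : ℕ → List Γ'} (h : S 1 = l) :
    Exec (.loop 1 (.pushVar 0)) (v, S)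
      (none, Function.update (Function.update S 1 []) 0 (l.reverse ++ S 0)) (2 * l.length + 1) := by
  have L := Exec.loop_list (i := 1) (c := .pushVar 0) l
    (fun j => Function.update (Function.update S 1 (l.drop j)) 0 ((l.take j).reverse ++ S 0))
    (fun _ => 1) (by intro j _; simp)
    (by
      intro j hj
      refine ⟨_, (Exec.pushVar ..).cast ?_⟩
      funext k
      simp only [Function.update_apply, List.take_add_one]
      grind) v
  simp only [List.drop_zero, List.take_zero, List.reverse_nil, List.nil_append, ← h,
    Function.update_eq_self] at L
  refine (L.cast ?_).mono ?_
  · simp [h]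
  · simp [h]; omega

theorem exec_len {ρ env : List ℕ} {d : ℕ} {T : List Γ'} {S : ℕ → List Γ'}
    (h : Represents ρ d env T S) (v) : ∃ v', Exec (comp len ρ d) (v, S)
      (v', Function.update S d (List.replicate (eval len env T) Γ'.blank))
      (cost len env T) := by
  have hd2 := h.two_le
  have hf := h.free
  have h0 := h.word
  have h1 := h.aux
  have L := Exec.loop_list (i := 0) (c := .seq (.pushVar 1) (.push d .blank)) T
    (fun j => Function.update (Function.update (Function.update S 0 (T.drop j)) 1
      (T.take j).reverse) d (List.replicate j Γ'.blank))
    (fun _ => 2) (by intro j _; grind [Function.update_apply])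
    (by
      intro j hj
      refine ⟨_, (Exec.seq (.pushVar ..) (.push ..)).cast ?_⟩
      funext k
      simp only [Function.update_apply, List.take_add_one]
      grind) v
  have e0 : (fun j => Function.update (Function.update (Function.update S 0 (T.drop j)) 1
      (T.take j).reverse) d (List.replicate j Γ'.blank)) 0 = S := by
    funext k
    simp only [Function.update_apply]
    grind
  simp only [] at e0
  rw [e0] at L
  have R := exec_restore T.reverse none (S := Function.update (Function.update
    (Function.update S 0 (T.drop T.length)) 1 (T.take T.length).reverse) d
    (List.replicate T.length Γ'.blank)) (by grind [Function.update_apply])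
  refine ⟨_, ((L.seq R).cast ?_).mono ?_⟩
  · funext k
    simp only [Function.update_apply, eval]
    grind
  · simp [cost]; omega

/-- The symbols before the position are moved to stack `1`, the next one is inspected, and the word
is restored. Past the end of the word, popping finds nothing and nothing is moved. -/
theorem exec_read (s : Γ') {e : NatExpr} {ρ env : List ℕ} {d : ℕ} {T : List Γ'} {S : ℕ → List Γ'}
    (ih : ∀ {ρ env d S}, Represents ρ d env T S → ∀ v, ∃ v', Exec (comp e ρ d) (v, S)
      (v', Function.update S d (List.replicate (eval e env T) Γ'.blank)) (cost e env T))
    (h : Represents ρ d env T S) (v) : ∃ v', Exec (comp (read s e) ρ d) (v, S)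
      (v', Function.update S d (List.replicate (eval (read s e) env T) Γ'.blank))
      (cost (read s e) env T) := by
  have hd2 := h.two_le
  have hf := h.free
  have h0 := h.word
  have h1 := h.aux
  obtain ⟨v1, E1⟩ := ih h v
  simp only [eval, cost, comp]
  generalize eval e env T = n at *
  have L := Exec.loop_replicate (i := d)
    (c := .seq (.pop 0) (.ite Option.isSome (.pushVar 1) .nop)) n
    (fun j => Function.update (Function.update (Function.update S 0 (T.drop j)) 1
      (T.take j).reverse) d (List.replicate (n - j) Γ'.blank))
    (fun _ => 3) (by intro j _; grind [Function.update_apply])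
    (by
      intro j hj
      by_cases hT : j < T.length
      · have hdr := List.drop_eq_getElem_cons hT
        refine ⟨_, (Exec.seq (.pop ..) (.iteTrue _ ?_ (.pushVar ..))).cast ?_⟩
        · simp only [Function.update_apply]; grind
        · funext k
          simp only [Function.update_apply, List.take_add_one]
          grind
      · have hdr : T.drop j = [] := List.drop_eq_nil_of_le (by omega)
        have hdr' : T.drop (j + 1) = [] := List.drop_eq_nil_of_le (by omega)
        have htk : T[j]? = none := List.getElem?_eq_none (by omega)
        refine ⟨_, (Exec.seq (.pop ..) (.iteFalse _ ?_ (.nop _))).cast ?_⟩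
        · simp only [Function.update_apply]; grind
        · funext k
          simp only [Function.update_apply, List.take_add_one]
          grind) v1
  have e0 : (fun j => Function.update (Function.update (Function.update S 0 (T.drop j)) 1
      (T.take j).reverse) d (List.replicate (n - j) Γ'.blank)) 0 =
      Function.update S d (List.replicate n Γ'.blank) := by
    funext k
    simp only [Function.update_apply]
    grind
  simp only [] at e0
  rw [e0] at L
  set S1 := Function.update (Function.update (Function.update S 0 (T.drop n)) 1
      (T.take n).reverse) d (List.replicate (n - n) Γ'.blank) with hS1
  have hS0 : S1 0 = T.drop n := by simp only [hS1, Function.update_apply]; grind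
  have hSa : S1 1 = (T.take n).reverse := by simp only [hS1, Function.update_apply]; grind
  have hSd : S1 d = [] := by simp only [hS1, Function.update_apply]; grind
  have hSk : ∀ k, k ≠ 0 → k ≠ 1 → k ≠ d → S1 k = S k := by
    intro k; simp only [hS1, Function.update_apply]; grind
  clear_value S1
  -- The inspected symbol is put back at once; 5 is the length of the longest branch.
  have key : ∃ v2, Exec (.seq (.pop 0)
      (.ite Option.isSome (.seq (.pushVar 0) (.ite (· == some s) (.push d .blank) .nop)) .nop))
      (none, S1) (v2, Function.update S1 d
        (List.replicate (if T[n]? = some s then 1 else 0) Γ'.blank)) 5 := by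
    by_cases hT : n < T.length
    · have hdr := List.drop_eq_getElem_cons hT
      have hh : (S1 0).head? = some T[n] := by rw [hS0]; simp [hT]
      have hn : T[n]? = some T[n] := List.getElem?_eq_getElem hT
      by_cases hs : T[n] = s
      · refine ⟨_, (Exec.seq (.pop ..) (.iteTrue _ ?_ (.seq (.pushVar ..)
          (.iteTrue _ ?_ (.push ..))))).cast ?_⟩
        · simp [hh]
        · simp [hh, hs]
        · funext k
          simp only [Function.update_apply, hh, hn, hs]
          grind
      · refine ⟨_, (Exec.seq (.pop ..) (.iteTrue _ ?_ (.seq (.pushVar ..)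
          (.iteFalse _ ?_ (.nop _))))).cast ?_⟩
        · simp [hh]
        · simp [hh, hs]
        · funext k
          simp only [Function.update_apply, hh, hn, Option.some.injEq, hs]
          grind
    · have hdr : T.drop n = [] := List.drop_eq_nil_of_le (by omega)
      have hn : T[n]? = none := List.getElem?_eq_none (by omega)
      have hh : (S1 0).head? = none := by rw [hS0, hdr]; rfl
      refine ⟨_, ((Exec.seq (.pop ..) (.iteFalse _ ?_ (.nop _))).cast ?_).mono
        (show 1 + (1 + 1) ≤ 5 by omega)⟩
      · simp [hh]
      · funext k
        simp only [Function.update_apply, hn]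
        grind
  obtain ⟨v2, K⟩ := key
  have R := exec_restore (T.take n).reverse v2 (S := Function.update S1 d
        (List.replicate (if T[n]? = some s then 1 else 0) Γ'.blank))
        (by simp only [Function.update_apply]; grind)
  refine ⟨_, ((((E1.seq L).seq K).seq R).cast ?_).mono ?_⟩
  · funext k
    have := hSk k
    have := List.take_append_drop n T
    simp only [Function.update_apply, List.reverse_reverse]
    grind
  · have := List.length_take_le n T
    simp only [List.length_reverse, Finset.sum_const, Finset.card_range, smul_eq_mul]
    omega

/-- The counter on stack `d` ends at the number of prepended bits and stays there while `c` is
evaluated, so it then tells how many symbols to remove from the word. -/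
theorem exec_build {n b c : NatExpr} {ρ env : List ℕ} {d : ℕ} {T : List Γ'} {S : ℕ → List Γ'}
    (ihn : ∀ {ρ env d T S}, Represents ρ d env T S → ∀ v, ∃ v', Exec (comp n ρ d) (v, S)
      (v', Function.update S d (List.replicate (eval n env T) Γ'.blank)) (cost n env T))
    (ihb : ∀ {ρ env d T S}, Represents ρ d env T S → ∀ v, ∃ v', Exec (comp b ρ d) (v, S)
      (v', Function.update S d (List.replicate (eval b env T) Γ'.blank)) (cost b env T))
    (ihc : ∀ {ρ env d T S}, Represents ρ d env T S → ∀ v, ∃ v', Exec (comp c ρ d) (v, S)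
      (v', Function.update S d (List.replicate (eval c env T) Γ'.blank)) (cost c env T))
    (h : Represents ρ d env T S) (v) : ∃ v', Exec (comp (build n b c) ρ d) (v, S)
      (v', Function.update S d (List.replicate (eval (build n b c) env T) Γ'.blank))
      (cost (build n b c) env T) := by
  have hd2 := h.two_le
  have hf := h.free
  have h0 := h.word
  have h1 := h.aux
  simp only [eval, cost, comp]
  have h' : Represents ρ (d + 1) env T S :=
    h.change (by omega) h0 h1 (fun j hj => hf j (by omega)) (fun _ _ _ => rfl)
  obtain ⟨v1, E1⟩ := ihn h' v
  generalize hN : eval n env T = N at *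
  set H : ℕ → List Γ' :=
    recVal T (fun x H => Γ'.bit (decide (eval b (x :: env) H ≠ 0)) :: H) with hH
  have hH0 : H 0 = T := rfl
  have hH1 : ∀ x, H (x + 1) = Γ'.bit (decide (eval b (x :: env) (H x) ≠ 0)) :: H x :=
    fun x => rfl
  have hHd : ∀ x, (H x).drop x = T := by
    intro x
    induction x with
    | zero => simp [hH0]
    | succ x ih => rw [hH1, List.drop_succ_cons, ih]
  have hHl : ∀ x, (H x).length = T.length + x := by
    intro x
    induction x with
    | zero => simp [hH0]
    | succ x ih => rw [hH1, List.length_cons, ih]; omega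
  clear_value H
  have L1 := Exec.loop_replicate (i := d + 1)
    (c := .seq (.seq (.seq (.seq (comp b (d :: ρ) (d + 2)) (.pop (d + 2)))
            (.ite Option.isSome (.push 0 (.bit true)) (.push 0 (.bit false))))
            (.loop (d + 2) .nop)) (.push d .blank)) N
    (fun j => Function.update (Function.update (Function.update S 0 (H j)) d
      (List.replicate j Γ'.blank)) (d + 1) (List.replicate (N - j) Γ'.blank))
    (fun x => cost b (x :: env) (H x) + 2 * eval b (x :: env) (H x) + 5)
    (by intro j _; simp)
    (by
      intro j hj
      set G := Function.update (Function.update (Function.update (Function.update S 0 (H j)) d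
        (List.replicate j Γ'.blank)) (d + 1) (List.replicate (N - j) Γ'.blank)) (d + 1)
        (List.replicate (N - j - 1) Γ'.blank) with hG
      have hGr : Represents (d :: ρ) (d + 2) (j :: env) (H j) G := by
        refine (h.change (by omega) ?_ ?_ ?_ ?_).cons ?_ ?_ ?_ <;>
          grind [Function.update_apply]
      obtain ⟨w, X1⟩ := ihb hGr (some Γ'.blank)
      have hH1' := hH1 j
      generalize eval b (j :: env) (H j) = r at *
      have X2 := Exec.pop (d + 2) w (Function.update G (d + 2) (List.replicate r Γ'.blank))
      set G2 := Function.update (Function.update G (d + 2) (List.replicate r Γ'.blank)) (d + 2)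
        (Function.update G (d + 2) (List.replicate r Γ'.blank) (d + 2)).tail with hG2
      have X3 : Exec (.ite Option.isSome (.push 0 (.bit true)) (.push 0 (.bit false)))
          ((Function.update G (d + 2) (List.replicate r Γ'.blank) (d + 2)).head?, G2)
          ((Function.update G (d + 2) (List.replicate r Γ'.blank) (d + 2)).head?,
            Function.update G2 0 (H (j + 1))) 2 := by
        have hG0 : G2 0 = H j := by simp only [hG2, hG, Function.update_apply]; grind
        rcases Nat.eq_zero_or_pos r with rfl | hr
        · refine (Exec.iteFalse _ (by simp) (.push ..)).cast ?_
          simp [hG0, hH1']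
        · refine (Exec.iteTrue _ ?_ (.push ..)).cast ?_
          · simp [List.head?_replicate]; omega
          · have : r ≠ 0 := by omega
            simp [hG0, hH1', this]
      have X4 := Exec.clear (d + 2) (r - 1)
        (Function.update G (d + 2) (List.replicate r Γ'.blank) (d + 2)).head?
        (Function.update G2 0 (H (j + 1))) (by simp [hG2])
      refine ⟨_, (((((X1.seq X2).seq X3).seq X4).seq (.push ..)).cast ?_).mono ?_⟩
      · funext k
        simp only [hG2, hG, Function.update_apply]
        grind
      · omega) v1
  have e0 : (fun j => Function.update (Function.update (Function.update S 0 (H j)) d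
      (List.replicate j Γ'.blank)) (d + 1) (List.replicate (N - j) Γ'.blank)) 0 =
      Function.update S (d + 1) (List.replicate N Γ'.blank) := by
    funext k
    simp only [Function.update_apply]
    grind
  simp only [] at e0
  rw [e0] at L1
  set S1 := Function.update (Function.update (Function.update S 0 (H N)) d
      (List.replicate N Γ'.blank)) (d + 1) (List.replicate (N - N) Γ'.blank) with hS1
  have hS1r : Represents ρ (d + 1) env (H N) S1 := by
    refine h.change (by omega) ?_ ?_ ?_ ?_ <;> grind [Function.update_apply]
  obtain ⟨v2, E2⟩ := ihc hS1r none
  generalize eval c env (H N) = r at *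
  have L2 := Exec.loop_replicate (i := d) (c := .pop 0) N
    (fun j => Function.update (Function.update (Function.update S 0 ((H N).drop j)) d
      (List.replicate (N - j) Γ'.blank)) (d + 1) (List.replicate r Γ'.blank)) (fun _ => 1)
    (by intro j _; simp)
    (by
      intro j hj
      refine ⟨_, (Exec.pop ..).cast ?_⟩
      funext k
      simp only [Function.update_apply]
      grind [List.tail_drop]) v2
  have e1 : (fun j => Function.update (Function.update (Function.update S 0 ((H N).drop j)) d
      (List.replicate (N - j) Γ'.blank)) (d + 1) (List.replicate r Γ'.blank)) 0 =
      Function.update S1 (d + 1) (List.replicate r Γ'.blank) := by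
    funext k
    simp only [hS1, Function.update_apply]
    grind
  simp only [] at e1
  rw [e1] at L2
  have L3 := Exec.move (i := d + 1) (j := d) (by omega) r none
    (Function.update (Function.update (Function.update S 0 ((H N).drop N)) d
      (List.replicate (N - N) Γ'.blank)) (d + 1) (List.replicate r Γ'.blank))
    (by simp) (by simp)
  refine ⟨_, (((((E1.seq L1).seq E2).seq L2).seq L3).cast ?_).mono ?_⟩
  · funext k
    simp only [hHd, Function.update_apply]
    grind
  · simp only [Nat.add_assoc, Nat.reduceAdd, Finset.sum_const, Finset.card_range, smul_eq_mul]
    omega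

/-- Compiled expressions compute the value within the cost. -/
theorem exec (e : NatExpr) {ρ env : List ℕ} {d : ℕ} {T : List Γ'} {S : ℕ → List Γ'}
    (h : Represents ρ d env T S) (v) : ∃ v', Exec (comp e ρ d) (v, S)
      (v', Function.update S d (List.replicate (eval e env T) Γ'.blank)) (cost e env T) := by
  induction e generalizing ρ env d T S v with
  | var i => exact exec_var i h v
  | zero =>
    refine ⟨v, (Exec.nop _).cast ?_⟩
    simp [eval, ← h.free d le_rfl]
  | succ e ih =>
    obtain ⟨v', h'⟩ := ih h v
    refine ⟨_, (h'.seq (.push ..)).cast ?_⟩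
    simp [eval, List.replicate_succ]
  | pred e ih =>
    obtain ⟨v', h'⟩ := ih h v
    refine ⟨_, (h'.seq (.pop ..)).cast ?_⟩
    simp [eval]
  | del j e ih => exact ih { h with vars := h.vars.eraseIdx j } v
  | fold n a b ihn iha ihb => exact exec_fold ihn iha ihb h v
  | read s e ih => exact exec_read s ih h v
  | len => exact exec_len h v
  | build n b c ihn ihb ihc => exact exec_build ihn ihb ihc h v

/-- The program that evaluates a closed expression on the input word, leaving in the register
whether the value is nonzero. -/
def program (e : NatExpr) : StackCmd :=
  .seq (.seq (comp e [] 2) (.loop 0 .nop)) (.pop 2)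

/-- The value is at most 1, so the single pop that fills the register also empties the result stack.
-/
theorem exec_program {e : NatExpr} {w : List Γ'} (he : eval e [] w ≤ 1) :
    Exec (program e) (none, Function.update (fun _ => []) 0 w)
      (if eval e [] w = 0 then none else some Γ'.blank, fun _ => [])
      (cost e [] w + 2 * w.length + 2) := by
  have h : Represents [] 2 [] w (Function.update (fun _ => []) 0 w) :=
    ⟨le_rfl, by simp, by simp, by intro j hj; simp [Function.update_apply]; omega, .nil⟩
  obtain ⟨v', h'⟩ := exec e h none
  set S := Function.update (Function.update (fun _ => []) 0 w) 2
    (List.replicate (eval e [] w) Γ'.blank) with hS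
  have L := Exec.loop_list (i := 0) (c := .nop) w
    (fun j => Function.update S 0 (w.drop j)) (fun _ => 1) (by simp)
    (by
      intro j hj
      refine ⟨_, (Exec.nop ..).cast ?_⟩
      simp) v'
  have hS0 : S 0 = w := by simp [hS]
  have e0 : Function.update S 0 (w.drop 0) = S := by
    rw [List.drop_zero, ← hS0, Function.update_eq_self]
  rw [e0] at L
  have P := ((h'.seq L).seq (.pop 2 none (Function.update S 0 (w.drop w.length)))).mono
    (u := cost e [] w + 2 * w.length + 2) (by simp; omega)
  have hh : (Function.update S 0 (w.drop w.length) 2).head? =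
      if eval e [] w = 0 then none else some Γ'.blank := by
    simp [hS, List.head?_replicate]
  rw [hh] at P
  refine P.cast ?_
  funext k
  have : eval e [] w - 1 = 0 := by omega
  simp only [hS, Function.update_apply, List.drop_length]
  split_ifs <;> simp_all

end NatExpr

/-! ### Polynomial bounds on values and costs -/

/-- `f` is bounded by a fixed power of `B`. -/
def PolyBdd {X : Type} (B f : X → ℕ) : Prop := ∃ c, ∀ x, f x ≤ B x ^ c

namespace PolyBdd

variable {X : Type} {B f g : X → ℕ}

theorem mono (hg : PolyBdd B g) (h : ∀ x, f x ≤ g x) : PolyBdd B f :=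
  hg.imp fun _ hc x => (h x).trans (hc x)

theorem const (hB : ∀ x, 2 ≤ B x) (n : ℕ) : PolyBdd B fun _ => n :=
  ⟨n, fun x => Nat.lt_two_pow_self.le.trans (Nat.pow_le_pow_left (hB x) n)⟩

theorem self : PolyBdd B B := ⟨1, fun x => by simp⟩

theorem mul (hf : PolyBdd B f) (hg : PolyBdd B g) : PolyBdd B fun x => f x * g x := by
  obtain ⟨a, ha⟩ := hf
  obtain ⟨b, hb⟩ := hg
  exact ⟨a + b, fun x => by rw [pow_add]; exact Nat.mul_le_mul (ha x) (hb x)⟩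

theorem add (hB : ∀ x, 2 ≤ B x) (hf : PolyBdd B f) (hg : PolyBdd B g) :
    PolyBdd B fun x => f x + g x := by
  obtain ⟨a, ha⟩ := hf
  obtain ⟨b, hb⟩ := hg
  refine ⟨max a b + 1, fun x => ?_⟩
  have h1 : 1 ≤ B x := (by decide : 1 ≤ 2).trans (hB x)
  have h2 := (ha x).trans (Nat.pow_le_pow_right h1 (le_max_left a b))
  have h3 := (hb x).trans (Nat.pow_le_pow_right h1 (le_max_right a b))
  rw [pow_succ]
  nlinarith [hB x]

theorem comp {Y : Type} {D : Y → ℕ} {h : Y → ℕ} {φ : X → Y} (hh : PolyBdd D h)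
    (hD : PolyBdd B fun x => D (φ x)) : PolyBdd B fun x => h (φ x) := by
  obtain ⟨a, ha⟩ := hh
  obtain ⟨b, hb⟩ := hD
  exact ⟨b * a, fun x => (ha _).trans (by rw [pow_mul]; exact Nat.pow_le_pow_left (hb x) a)⟩

end PolyBdd

/-- A context for the evaluation of expressions, with a bound on its entries. -/
structure EvalContext where
  env : List ℕ
  word : List Γ'
  size : ℕ
  two_le : 2 ≤ size
  env_le : ∀ v ∈ env, v ≤ size
  word_le : word.length ≤ size

namespace NatExpr

/-- The value and the cost of `e` are polynomially bounded. -/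
def IsPoly (e : NatExpr) : Prop :=
  PolyBdd EvalContext.size (fun x => eval e x.env x.word) ∧
    PolyBdd EvalContext.size (fun x => cost e x.env x.word)

theorem _root_.EvalContext.polyBdd_const (n : ℕ) : PolyBdd EvalContext.size fun _ => n :=
  .const EvalContext.two_le n

theorem _root_.PolyBdd.add' {f g : EvalContext → ℕ} (hf : PolyBdd EvalContext.size f)
    (hg : PolyBdd EvalContext.size g) : PolyBdd EvalContext.size fun x => f x + g x :=
  .add EvalContext.two_le hf hg

/-- Here `M` bounds everything a round can see, so each step costs at most `M ^ c`. Stated for a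
single context, the estimate also serves for a power, where the intermediate values have no
polynomial bound. -/
theorem cost_fold_le {n a b : NatExpr} {c : ℕ} {env : List ℕ} {T : List Γ'} {M : ℕ}
    (hb : ∀ x : EvalContext, cost b x.env x.word ≤ x.size ^ c) (hM : 2 ≤ M)
    (henv : ∀ v ∈ env, v ≤ M) (hT : T.length ≤ M) (hn : eval n env T ≤ M)
    (hI : ∀ i ≤ eval n env T,
      recVal (eval a env T) (fun x acc => eval b (x :: acc :: env) T) i ≤ M) :
    cost (fold n a b) env T ≤
      cost a env T + cost n env T + M * (M ^ c + 4 * M + 4) + 2 * M + 2 := by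
  simp only [cost]
  set A := recVal (eval a env T) (fun x acc => eval b (x :: acc :: env) T)
  have h : ∀ i ∈ Finset.range (eval n env T),
      cost b (i :: A i :: env) T + 2 * A i + 2 * A (i + 1) + 4 ≤ M ^ c + 4 * M + 4 := by
    intro i hi
    have hi := Finset.mem_range.1 hi
    have h1 := hI i hi.le
    have h2 := hI (i + 1) hi
    have h3 := hb ⟨i :: A i :: env, T, M, hM, by
      intro v hv
      rcases List.mem_cons.1 hv with rfl | hv
      · omega
      · rcases List.mem_cons.1 hv with rfl | hv
        · exact h1
        · exact henv v hv, hT⟩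
    simp only at h3
    omega
  have h1 := Finset.sum_le_card_nsmul _ _ _ h
  rw [Finset.card_range, smul_eq_mul] at h1
  have h2 := Nat.mul_le_mul_right (M ^ c + 4 * M + 4) hn
  omega

theorem IsPoly.var (i : ℕ) : IsPoly (var i) := by
  have h : ∀ x : EvalContext, x.env.getD i 0 ≤ x.size := by
    intro x
    rw [List.getD_eq_getElem?_getD]
    rcases lt_or_ge i x.env.length with hi | hi
    · simpa [hi] using x.env_le _ (List.getElem_mem hi)
    · simp [hi]
  refine ⟨PolyBdd.self.mono h, ?_⟩
  exact (((EvalContext.polyBdd_const 5).mul .self).add' (EvalContext.polyBdd_const 2)).mono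
    fun x => by simp only [cost]; have := h x; omega

theorem IsPoly.zero : IsPoly zero :=
  ⟨EvalContext.polyBdd_const 0, EvalContext.polyBdd_const 1⟩

theorem IsPoly.succ {e : NatExpr} (h : IsPoly e) : IsPoly (succ e) :=
  ⟨h.1.add' (EvalContext.polyBdd_const 1), h.2.add' (EvalContext.polyBdd_const 1)⟩

theorem IsPoly.pred {e : NatExpr} (h : IsPoly e) : IsPoly (pred e) :=
  ⟨h.1.mono fun _ => Nat.sub_le _ _, h.2.add' (EvalContext.polyBdd_const 1)⟩

theorem IsPoly.del (j : ℕ) {e : NatExpr} (h : IsPoly e) : IsPoly (del j e) := by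
  obtain ⟨⟨a, ha⟩, ⟨b, hb⟩⟩ := h
  let φ (x : EvalContext) : EvalContext :=
    ⟨x.env.eraseIdx j, x.word, x.size, x.two_le,
      fun v hv => x.env_le v (List.mem_of_mem_eraseIdx hv), x.word_le⟩
  exact ⟨⟨a, fun x => ha (φ x)⟩, ⟨b, fun x => hb (φ x)⟩⟩

theorem IsPoly.read (s : Γ') {e : NatExpr} (h : IsPoly e) : IsPoly (read s e) := by
  refine ⟨(EvalContext.polyBdd_const 1).mono fun x => ?_, ?_⟩
  · simp only [eval]; split_ifs <;> simp
  · exact (h.2.add' ((EvalContext.polyBdd_const 6).mul h.1)).add' (EvalContext.polyBdd_const 8)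

theorem IsPoly.len : IsPoly len := by
  refine ⟨PolyBdd.self.mono EvalContext.word_le, ?_⟩
  exact (((EvalContext.polyBdd_const 5).mul .self).add' (EvalContext.polyBdd_const 2)).mono
    fun x => by simp only [cost]; have := x.word_le; omega

/-- Iterating a polynomial step can produce exponentially large values, so a bound `g` on all
intermediate values has to be supplied. -/
theorem IsPoly.fold {n a b : NatExpr} (hn : IsPoly n) (ha : IsPoly a) (hb : IsPoly b)
    {g : EvalContext → ℕ} (hg : PolyBdd EvalContext.size g)
    (hI : ∀ x : EvalContext, ∀ i ≤ eval n x.env x.word,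
      recVal (eval a x.env x.word) (fun y acc => eval b (y :: acc :: x.env) x.word) i ≤ g x) :
    IsPoly (fold n a b) := by
  refine ⟨hg.mono fun x => hI x _ le_rfl, ?_⟩
  obtain ⟨c, hc⟩ := hb.2
  have hM : PolyBdd EvalContext.size fun x => x.size + eval n x.env x.word + g x :=
    (PolyBdd.self.add' hn.1).add' hg
  have hMc : PolyBdd EvalContext.size fun x => (x.size + eval n x.env x.word + g x) ^ c :=
    PolyBdd.comp (D := id) (h := fun y => y ^ c)
      (φ := fun x : EvalContext => x.size + eval n x.env x.word + g x) ⟨c, fun _ => le_rfl⟩ hM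
  have K := EvalContext.polyBdd_const
  refine PolyBdd.mono (((ha.2.add' hn.2).add' (hM.mul ((hMc.add' ((K 4).mul hM)).add' (K 4)))).add'
    ((K 2).mul hM) |>.add' (K 2)) fun x => ?_
  refine cost_fold_le hc (by have := x.two_le; omega)
    (fun v hv => by have := x.env_le v hv; omega) (by have := x.word_le; omega) (by omega)
    fun i hi => by have := hI x i hi; omega

/-- The word grows by one symbol per round, so all evaluations take place in contexts of size
`x.size + eval n x.env x.word`. -/
theorem IsPoly.build {n b c : NatExpr} (hn : IsPoly n) (hb : IsPoly b) (hc : IsPoly c) :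
    IsPoly (build n b c) := by
  have K := EvalContext.polyBdd_const
  have hM : PolyBdd EvalContext.size fun x => x.size + eval n x.env x.word :=
    PolyBdd.self.add' hn.1
  have hMp : ∀ c, PolyBdd EvalContext.size fun x => (x.size + eval n x.env x.word) ^ c :=
    fun c => PolyBdd.comp (D := id) (h := fun y => y ^ c)
      (φ := fun x : EvalContext => x.size + eval n x.env x.word) ⟨c, fun _ => le_rfl⟩ hM
  obtain ⟨⟨b1, hb1⟩, ⟨b2, hb2⟩⟩ := hb
  obtain ⟨⟨c1, hc1⟩, ⟨c2, hc2⟩⟩ := hc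
  let H (x : EvalContext) : ℕ → List Γ' :=
    recVal x.word (fun y H => Γ'.bit (decide (eval b (y :: x.env) H ≠ 0)) :: H)
  have hH : ∀ x i, (H x i).length = x.word.length + i := by
    intro x i
    induction i with
    | zero => rfl
    | succ i ih =>
      change (H x i).length + 1 = _
      omega
  let φ (x : EvalContext) : EvalContext :=
    ⟨x.env, H x (eval n x.env x.word), x.size + eval n x.env x.word, by have := x.two_le; omega,
      fun v hv => by have := x.env_le v hv; omega,
      by rw [hH]; have := x.word_le; omega⟩
  have hcv : ∀ x : EvalContext, eval c x.env (H x (eval n x.env x.word)) ≤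
      (x.size + eval n x.env x.word) ^ c1 := fun x => hc1 (φ x)
  have hcc : ∀ x : EvalContext, cost c x.env (H x (eval n x.env x.word)) ≤
      (x.size + eval n x.env x.word) ^ c2 := fun x => hc2 (φ x)
  refine ⟨(hMp c1).mono hcv, ?_⟩
  refine PolyBdd.mono ((((hn.2.add'
    (hM.mul (((hMp b2).add' ((K 2).mul (hMp b1))).add' (K 6)))).add' (hMp c2)).add'
    ((K 2).mul hn.1)).add' ((K 2).mul (hMp c1)) |>.add' (K 4)) fun x => ?_
  have hs : ∀ i ∈ Finset.range (eval n x.env x.word),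
      cost b (i :: x.env) (H x i) + 2 * eval b (i :: x.env) (H x i) + 6 ≤
      (x.size + eval n x.env x.word) ^ b2 + 2 * (x.size + eval n x.env x.word) ^ b1 + 6 := by
    intro i hi
    have hi := Finset.mem_range.1 hi
    let ψ : EvalContext := ⟨i :: x.env, H x i, x.size + eval n x.env x.word,
      by have := x.two_le; omega, by
        intro v hv
        rcases List.mem_cons.1 hv with rfl | hv
        · omega
        · have := x.env_le v hv; omega, by rw [hH]; have := x.word_le; omega⟩
    have h1 : eval b (i :: x.env) (H x i) ≤ (x.size + eval n x.env x.word) ^ b1 := hb1 ψ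
    have h2 : cost b (i :: x.env) (H x i) ≤ (x.size + eval n x.env x.word) ^ b2 := hb2 ψ
    omega
  have h1 := Finset.sum_le_card_nsmul _ _ _ hs
  rw [Finset.card_range, smul_eq_mul] at h1
  have h2 := Nat.mul_le_mul_right ((x.size + eval n x.env x.word) ^ b2 +
    2 * (x.size + eval n x.env x.word) ^ b1 + 6) (Nat.le_add_left (eval n x.env x.word) x.size)
  have h3 := hcv x
  have h4 := hcc x
  simp only [cost]
  change _ + ∑ i ∈ Finset.range (eval n x.env x.word),
    (cost b (i :: x.env) (H x i) + 2 * eval b (i :: x.env) (H x i) + 6) +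
    cost c x.env (H x (eval n x.env x.word)) + _ +
    2 * eval c x.env (H x (eval n x.env x.word)) + _ ≤ _
  omega

/-! Derived operations. -/

def const : ℕ → NatExpr
  | 0 => zero
  | n + 1 => succ (const n)

def add (a b : NatExpr) : NatExpr := fold b a (succ (var 1))

def sub (a b : NatExpr) : NatExpr := fold b a (pred (var 1))

/-- The sum of `f` over variable `0` from `0` to `n - 1`. -/
def sum (n f : NatExpr) : NatExpr := fold n zero (add (var 1) (del 1 f))

/-- Here and below, `del` discards the counters and accumulators that a recursion puts in front of
the environment. -/
def mul (a b : NatExpr) : NatExpr := sum a (del 0 b)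

/-- `1` if the value is `0`, and `0` otherwise. -/
def not (a : NatExpr) : NatExpr := sub (const 1) a

/-- `1` if `a < b`, and `0` otherwise. -/
def lt (a b : NatExpr) : NatExpr := not (not (sub b a))

/-- `a / b` for `b ≠ 0`. -/
def div (a b : NatExpr) : NatExpr :=
  sum a (not (lt (del 0 a) (mul (succ (var 0)) (del 0 b))))

/-- `a % b` for `b ≠ 0`. -/
def mod (a b : NatExpr) : NatExpr := sub a (mul b (div a b))

/-- `a / b ^ j` for `b ≠ 0`. -/
def shift (a b j : NatExpr) : NatExpr := fold j a (div (var 1) (del 0 (del 0 b)))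

/-- Its value is not polynomially bounded. It serves only to compute the number of certificates,
whose cost is estimated separately. -/
def pow (a b : NatExpr) : NatExpr := fold b (const 1) (mul (var 1) (del 0 (del 0 a)))

/-- `b`, with variable `0` standing for `a`. -/
def letIn (a b : NatExpr) : NatExpr := fold (const 1) a (del 0 b)

section eval

variable (a b f : NatExpr) (env : List ℕ) (T : List Γ')

@[simp] theorem eval_const (n : ℕ) : eval (const n) env T = n := by
  induction n with
  | zero => rfl
  | succ n ih => simp [const, eval, ih]

@[simp] theorem eval_add : eval (add a b) env T = eval a env T + eval b env T := by
  simp only [add, eval]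
  induction eval b env T with
  | zero => rfl
  | succ n ih => simp only [recVal, ih]; rfl

@[simp] theorem eval_sub : eval (sub a b) env T = eval a env T - eval b env T := by
  simp only [sub, eval]
  induction eval b env T with
  | zero => rfl
  | succ n ih => simp only [recVal, ih]; rfl

theorem recVal_sum (n : ℕ) :
    recVal 0 (fun x acc => eval (add (var 1) (del 1 f)) (x :: acc :: env) T) n =
      ∑ x ∈ Finset.range n, eval f (x :: env) T := by
  induction n with
  | zero => rfl
  | succ n ih =>
    rw [Finset.sum_range_succ, ← ih]
    simp only [recVal, eval_add]
    rfl

@[simp] theorem eval_sum (n : NatExpr) :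
    eval (sum n f) env T = ∑ x ∈ Finset.range (eval n env T), eval f (x :: env) T :=
  recVal_sum f env T _

@[simp] theorem eval_del_cons (x : ℕ) : eval (del 0 a) (x :: env) T = eval a env T := rfl

@[simp] theorem eval_var_zero (x : ℕ) : eval (var 0) (x :: env) T = x := rfl

@[simp] theorem eval_var_succ (i x : ℕ) : eval (var (i + 1)) (x :: env) T = eval (var i) env T :=
  rfl

@[simp] theorem eval_mul : eval (mul a b) env T = eval a env T * eval b env T := by
  simp [mul]

@[simp] theorem eval_not : eval (not a) env T = if eval a env T = 0 then 1 else 0 := by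
  simp only [not, eval_sub, eval_const]
  split_ifs with h <;> omega

@[simp] theorem eval_lt :
    eval (lt a b) env T = if eval a env T < eval b env T then 1 else 0 := by
  simp only [lt, eval_not, eval_sub]
  split_ifs <;> omega

theorem eval_div_le : eval (div a b) env T ≤ eval a env T := by
  rw [div, eval_sum]
  refine (Finset.sum_le_card_nsmul _ _ 1 fun x _ => ?_).trans (by simp)
  rw [eval_not]
  split_ifs <;> simp

/-- The sum counts the `x` below the dividend with `(x + 1) * q ≤ m`, that is, those below the
quotient; the range is long enough because `m / q ≤ m`. -/
theorem eval_div (hb : eval b env T ≠ 0) :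
    eval (div a b) env T = eval a env T / eval b env T := by
  simp only [div, eval_sum, eval_not, eval_lt, eval_mul, eval_del_cons]
  generalize eval a env T = m at *
  generalize eval b env T = q at *
  have hq : 0 < q := Nat.pos_of_ne_zero hb
  have h : ∀ x ∈ Finset.range m, (if (if m < eval (succ (var 0)) (x :: env) T * q then 1 else 0) = 0
      then 1 else 0) = if x < m / q then 1 else 0 := by
    intro x _
    have : eval (succ (var 0)) (x :: env) T = x + 1 := rfl
    rw [this]
    have h1 : x < m / q ↔ (x + 1) * q ≤ m := by
      rw [← Nat.succ_le_iff, Nat.le_div_iff_mul_le hq]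
    split_ifs <;> omega
  rw [Finset.sum_congr rfl h, Finset.sum_ite, Finset.sum_const_zero, Nat.add_zero,
    Finset.sum_const, smul_eq_mul, Nat.mul_one]
  have : (Finset.range m).filter (fun x => x < m / q) = Finset.range (m / q) := by
    ext x
    simp only [Finset.mem_filter, Finset.mem_range]
    have := Nat.div_le_self m q
    omega
  rw [this, Finset.card_range]

theorem eval_mod (hb : eval b env T ≠ 0) :
    eval (mod a b) env T = eval a env T % eval b env T := by
  simp only [mod, eval_sub, eval_mul, eval_div _ _ _ _ hb]
  have := Nat.div_add_mod (eval a env T) (eval b env T)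
  omega

theorem recVal_shift_le (n : ℕ) : recVal (eval a env T)
    (fun x acc => eval (div (var 1) (del 0 (del 0 b))) (x :: acc :: env) T) n ≤ eval a env T := by
  induction n with
  | zero => exact le_rfl
  | succ n ih => exact (eval_div_le _ _ _ _).trans ih

theorem eval_shift (j : NatExpr) (hb : eval b env T ≠ 0) :
    eval (shift a b j) env T = eval a env T / eval b env T ^ eval j env T := by
  simp only [shift, eval]
  induction eval j env T with
  | zero => simp [recVal]
  | succ n ih =>
    rw [pow_succ, ← Nat.div_div_eq_div_mul, ← ih]
    exact eval_div (var 1) (del 0 (del 0 b)) (n :: _ :: env) T hb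

theorem recVal_pow (n : ℕ) : recVal (eval (const 1) env T)
    (fun x acc => eval (mul (var 1) (del 0 (del 0 a))) (x :: acc :: env) T) n =
      eval a env T ^ n := by
  induction n with
  | zero => simp [recVal]
  | succ n ih =>
    rw [pow_succ, ← ih]
    exact eval_mul (var 1) (del 0 (del 0 a)) (n :: _ :: env) T

@[simp] theorem eval_pow : eval (pow a b) env T = eval a env T ^ eval b env T :=
  recVal_pow a env T _

@[simp] theorem eval_letIn : eval (letIn a b) env T = eval b (eval a env T :: env) T := by
  simp only [letIn, eval, eval_const]
  rfl

end eval

theorem IsPoly.const (n : ℕ) : IsPoly (const n) := by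
  induction n with
  | zero => exact .zero
  | succ n ih => exact ih.succ

theorem IsPoly.add {a b : NatExpr} (ha : IsPoly a) (hb : IsPoly b) : IsPoly (add a b) := by
  refine hb.fold ha (IsPoly.var 1).succ (ha.1.add' hb.1) fun x i hi => ?_
  refine le_trans (le_of_eq ?_) (Nat.add_le_add_left hi _)
  clear hi
  induction i with
  | zero => rfl
  | succ i ih => simp only [recVal, ih]; rfl

theorem IsPoly.sub {a b : NatExpr} (ha : IsPoly a) (hb : IsPoly b) : IsPoly (sub a b) := by
  refine hb.fold ha (IsPoly.var 1).pred ha.1 fun x i _ => ?_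
  induction i with
  | zero => exact le_rfl
  | succ i ih => exact (Nat.sub_le _ _).trans (ih (by omega))

theorem IsPoly.sum {n f : NatExpr} (hn : IsPoly n) (hf : IsPoly f) : IsPoly (sum n f) := by
  obtain ⟨c, hc⟩ := hf.1
  have hM : PolyBdd EvalContext.size fun x => x.size + eval n x.env x.word :=
    PolyBdd.self.add' hn.1
  have hMp : PolyBdd EvalContext.size fun x => (x.size + eval n x.env x.word) ^ c :=
    PolyBdd.comp (D := id) (h := fun y => y ^ c)
      (φ := fun x : EvalContext => x.size + eval n x.env x.word) ⟨c, fun _ => le_rfl⟩ hM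
  refine hn.fold .zero ((IsPoly.var 1).add (hf.del 1)) (hn.1.mul hMp) fun x i hi => ?_
  refine (recVal_sum f x.env x.word i).le.trans
    ((Finset.sum_le_card_nsmul _ _ ((x.size + eval n x.env x.word) ^ c) fun y hy => ?_).trans ?_)
  · have hy := Finset.mem_range.1 hy
    exact hc ⟨y :: x.env, x.word, x.size + eval n x.env x.word, by have := x.two_le; omega, by
      intro v hv
      rcases List.mem_cons.1 hv with rfl | hv
      · omega
      · have := x.env_le v hv; omega, by have := x.word_le; omega⟩
  · rw [Finset.card_range, smul_eq_mul]
    exact Nat.mul_le_mul_right _ hi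

theorem IsPoly.mul {a b : NatExpr} (ha : IsPoly a) (hb : IsPoly b) : IsPoly (mul a b) :=
  ha.sum (hb.del 0)

theorem IsPoly.not {a : NatExpr} (ha : IsPoly a) : IsPoly (not a) := (IsPoly.const 1).sub ha

theorem IsPoly.lt {a b : NatExpr} (ha : IsPoly a) (hb : IsPoly b) : IsPoly (lt a b) :=
  (hb.sub ha).not.not

theorem IsPoly.div {a b : NatExpr} (ha : IsPoly a) (hb : IsPoly b) : IsPoly (div a b) :=
  ha.sum ((ha.del 0).lt ((IsPoly.var 0).succ.mul (hb.del 0))).not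

theorem IsPoly.mod {a b : NatExpr} (ha : IsPoly a) (hb : IsPoly b) : IsPoly (mod a b) :=
  ha.sub (hb.mul (ha.div hb))

/-- Dividing repeatedly, instead of once by a power, keeps all intermediate values below that of
`a`. -/
theorem IsPoly.shift {a b j : NatExpr} (ha : IsPoly a) (hb : IsPoly b) (hj : IsPoly j) :
    IsPoly (shift a b j) :=
  hj.fold ha ((IsPoly.var 1).div ((hb.del 0).del 0)) ha.1
    fun x i _ => recVal_shift_le a b x.env x.word i

theorem IsPoly.letIn {a b : NatExpr} (ha : IsPoly a) (hb : IsPoly b) : IsPoly (letIn a b) := by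
  obtain ⟨c, hc⟩ := hb.1
  have hM : PolyBdd EvalContext.size fun x => x.size + eval a x.env x.word :=
    PolyBdd.self.add' ha.1
  have hMp : PolyBdd EvalContext.size fun x => (x.size + eval a x.env x.word) ^ c :=
    PolyBdd.comp (D := id) (h := fun y => y ^ c)
      (φ := fun x : EvalContext => x.size + eval a x.env x.word) ⟨c, fun _ => le_rfl⟩ hM
  refine (IsPoly.const 1).fold ha (hb.del 0) (ha.1.add' hMp) fun x i hi => ?_
  rw [eval_const] at hi
  interval_cases i
  · exact Nat.le_add_right _ _
  · refine le_trans ?_ (Nat.le_add_left _ _)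
    exact hc ⟨eval a x.env x.word :: x.env, x.word, x.size + eval a x.env x.word,
      by have := x.two_le; omega, by
      intro v hv
      rcases List.mem_cons.1 hv with rfl | hv
      · omega
      · have := x.env_le v hv; omega, by have := x.word_le; omega⟩

theorem cost_letIn (a b : NatExpr) (env : List ℕ) (T : List Γ') :
    cost (letIn a b) env T = cost a env T + cost b (eval a env T :: env) T +
      2 * eval a env T + 2 * eval b (eval a env T :: env) T + 10 := by
  have : cost (const 1) env T = 2 := rfl
  simp only [letIn, cost, this, eval_const, Finset.sum_range_one, recVal, List.eraseIdx_zero,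
    List.tail_cons, eval_del_cons]
  omega

end NatExpr

/-! ### Encoding maximal independent sets by few edges -/

namespace SimpleGraph

/-- `G` has no induced matching of `s` edges inside `A`. -/
def NoInducedMatching {V : Type} (G : SimpleGraph V) (s : ℕ) (A : Set V) : Prop :=
  ∀ l : List (V × V), l.length = s → (∀ p ∈ l, p.1 ∈ A ∧ p.2 ∈ A ∧ G.Adj p.1 p.2) →
    ¬ l.Pairwise fun p q =>
      ¬ G.Adj p.1 q.1 ∧ ¬ G.Adj p.1 q.2 ∧ ¬ G.Adj p.2 q.1 ∧ ¬ G.Adj p.2 q.2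

/-- An induced matching given as a list of pairs is an induced copy of `sP₂`. The vertices are
distinct: if two pairs shared an end, it would be adjacent to the other end of either pair, which
gives an edge between the pairs. -/
theorem _root_.IsSP2Free.noInducedMatching {V : Type} {G : SimpleGraph V} {s : ℕ}
    (h : IsSP2Free s G) (A : Set V) : G.NoInducedMatching s A := by
  rintro l rfl hl hp
  refine h ⟨⟨⟨fun x => if x.2 = 0 then l[x.1].1 else l[x.1].2, ?_⟩, ?_⟩⟩
  all_goals
    have hadj : ∀ i : Fin l.length, G.Adj l[i].1 l[i].2 := fun i =>
      (hl _ (List.getElem_mem i.2)).2.2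
    have hne : ∀ i j : Fin l.length, i ≠ j → ¬ G.Adj l[i].1 l[j].1 ∧ ¬ G.Adj l[i].1 l[j].2 ∧
        ¬ G.Adj l[i].2 l[j].1 ∧ ¬ G.Adj l[i].2 l[j].2 := by
      intro i j hij
      rcases lt_or_gt_of_ne hij with hij | hij
      · exact List.pairwise_iff_getElem.1 hp i j i.2 j.2 hij
      · obtain ⟨h1, h2, h3, h4⟩ := List.pairwise_iff_getElem.1 hp j i j.2 i.2 hij
        exact ⟨fun h => h1 h.symm, fun h => h3 h.symm, fun h => h2 h.symm, fun h => h4 h.symm⟩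
  · rintro ⟨i, a⟩ ⟨j, b⟩ hab
    simp only at hab
    have hi := hadj i
    have hj := hadj j
    by_cases hij : i = j
    · subst hij
      have := hi.ne
      fin_cases a <;> fin_cases b <;> simp_all
    · exfalso
      obtain ⟨h1, h2, h3, h4⟩ := hne i j hij
      split_ifs at hab
      · exact h2 (hab ▸ hj)
      · exact h1 (hab ▸ hj.symm)
      · exact h4 (hab ▸ hj)
      · exact h3 (hab ▸ hj.symm)
  · rintro ⟨i, a⟩ ⟨j, b⟩
    change G.Adj (if a = 0 then l[i].1 else l[i].2) (if b = 0 then l[j].1 else l[j].2) ↔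
      i = j ∧ (pathGraph 2).Adj a b
    have hi : G.Adj l[i.val].1 l[i.val].2 := hadj i
    rw [pathGraph_adj]
    by_cases hij : i = j
    · subst hij
      fin_cases a <;> fin_cases b <;> simp [hi, hi.symm]
    · obtain ⟨h1, h2, h3, h4⟩ := hne i j hij
      simp only [hij, false_and, iff_false]
      split_ifs <;> assumption

/-- In a graph without induced matchings of `r + 1` edges, every maximal independent set arises
from the greedy procedure, run on the vertices in increasing order, with `r` edges whose
neighbours are forbidden below their second end. -/
theorem NoInducedMatching.exists_edges {V : Type} [LinearOrder V] [Finite V] {G : SimpleGraph V}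
    {r : ℕ} : ∀ {A J : Set V}, G.NoInducedMatching (r + 1) A → J ⊆ A →
    (∀ x ∈ J, ∀ y ∈ J, ¬ G.Adj x y) → (∀ w ∈ A, w ∉ J → ∃ x ∈ J, G.Adj w x) →
    ∃ l : List (V × V), l.length ≤ r ∧ (∀ p ∈ l, p.2 ∈ A) ∧
      ∀ w, w ∈ J ↔ w ∈ A ∧ (∀ x ∈ J, x < w → ¬ G.Adj w x) ∧
        ∀ p ∈ l, w < p.2 → ¬ G.Adj w p.1 ∧ ¬ G.Adj w p.2 := by
  induction r with
  | zero =>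
    intro A J hA hJA hJ hmax
    refine ⟨[], le_rfl, by simp, fun w => ⟨fun hw => ⟨hJA hw, fun x hx _ => hJ w hw x hx, by simp⟩,
      fun hw => ?_⟩⟩
    by_contra hwJ
    obtain ⟨x, hx, hwx⟩ := hmax w hw.1 hwJ
    -- A single edge inside `A` is already a forbidden induced matching.
    refine hA [(w, x)] rfl ?_ (List.pairwise_singleton _ _)
    simpa using ⟨hw.1, hJA hx, hwx⟩
  | succ r ih =>
    intro A J hA hJA hJ hmax
    -- the second ends of edges from a vertex outside `J` to its least neighbour in `J`,
    -- if that neighbour is larger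
    set B : Set V := {v | v ∈ J ∧ ∃ u ∈ A, u < v ∧ G.Adj u v ∧ ∀ x ∈ J, x < v → ¬ G.Adj u x}
      with hB
    have hleast : ∀ w ∈ A, w ∉ J → ∃ x ∈ J, G.Adj w x ∧ ∀ y ∈ J, y < x → ¬ G.Adj w y := by
      intro w hw hwJ
      obtain ⟨x, ⟨hxJ, hwx⟩, hmin⟩ := Set.exists_min_image {x | x ∈ J ∧ G.Adj w x} id
        (Set.toFinite _) (hmax w hw hwJ)
      exact ⟨x, hxJ, hwx, fun y hy hyx hwy => absurd (hmin y ⟨hy, hwy⟩) (not_le.2 hyx)⟩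
    rcases B.eq_empty_or_nonempty with hBe | hBn
    -- Now every vertex of `A` outside `J` has a smaller neighbour in `J`, so the plain greedy
    -- procedure finds `J`.
    · refine ⟨[], by simp, by simp, fun w => ⟨fun hw => ⟨hJA hw, fun x hx _ => hJ w hw x hx,
        by simp⟩, fun hw => ?_⟩⟩
      by_contra hwJ
      obtain ⟨x, hxJ, hwx, hx⟩ := hleast w hw.1 hwJ
      rcases lt_trichotomy x w with h | h | h
      · exact hw.2.1 x hxJ h hwx
      · exact hwx.ne h.symm
      · have : x ∈ B := ⟨hxJ, w, hw.1, h, hwx, hx⟩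
        rw [hBe] at this
        exact this
    · obtain ⟨v, ⟨hvJ, u, huA, huv, huvA, hu⟩, hv⟩ :=
        Set.exists_max_image B id (Set.toFinite _) hBn
      simp only [id] at hv
      -- The edge `uv` extends any induced matching in this set by one edge.
      have hA' : G.NoInducedMatching (r + 1) {w | w ∈ A ∧ w < v ∧ ¬ G.Adj w u ∧ ¬ G.Adj w v} := by
        intro l hl hlA hp
        refine hA ((u, v) :: l) (by simp [hl]) ?_ (List.pairwise_cons.2 ⟨?_, hp⟩)
        · intro p hpl
          rcases List.mem_cons.1 hpl with rfl | hpl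
          · exact ⟨huA, hJA hvJ, huvA⟩
          · exact ⟨(hlA p hpl).1.1, (hlA p hpl).2.1.1, (hlA p hpl).2.2⟩
        · intro p hpl
          obtain ⟨⟨_, _, h1, h2⟩, ⟨_, _, h3, h4⟩, _⟩ := hlA p hpl
          exact ⟨fun h => h1 h.symm, fun h => h3 h.symm, fun h => h2 h.symm, fun h => h4 h.symm⟩
      -- The part of `J` below `v` is maximal in the smaller set: the least neighbour in `J` of an
      -- outside vertex `w` is not `v`, as `w` and `v` are not adjacent, and not beyond `v`, as `v`
      -- is the largest element of `B`.
      obtain ⟨l, hl, hlA, hlJ⟩ := ih (J := {w | w ∈ J ∧ w < v}) hA'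
        (fun w hw => ⟨hJA hw.1, hw.2, fun h => hu w hw.1 hw.2 h.symm, hJ w hw.1 v hvJ⟩)
        (fun x hx y hy => hJ x hx.1 y hy.1)
        (by
          rintro w ⟨hwA, hwv, hwu, hwv'⟩ hwJ
          have hwJ' : w ∉ J := fun h => hwJ ⟨h, hwv⟩
          obtain ⟨x, hxJ, hwx, hx⟩ := hleast w hwA hwJ'
          refine ⟨x, ⟨hxJ, ?_⟩, hwx⟩
          by_contra hxv
          rcases (not_lt.1 hxv).eq_or_lt with rfl | hvx
          · exact hwv' hwx
          · exact absurd (hv x ⟨hxJ, w, hwA, hwv.trans hvx, hwx, hx⟩) (not_le.2 hvx))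
      refine ⟨(u, v) :: l, by simpa using hl, ?_, fun w => ⟨fun hw => ⟨hJA hw,
        fun x hx _ => hJ w hw x hx, ?_⟩, ?_⟩⟩
      · intro p hp
        rcases List.mem_cons.1 hp with rfl | hp
        · exact hJA hvJ
        · exact (hlA p hp).1
      · intro p hp hwp
        rcases List.mem_cons.1 hp with rfl | hp
        · exact ⟨fun h => hu w hw hwp h.symm, hJ w hw v hvJ⟩
        · exact ((hlJ w).1 ⟨hw, hwp.trans (hlA p hp).2.1⟩).2.2 p hp hwp
      · rintro ⟨hwA, hwJ, hwl⟩
        rcases lt_or_ge w v with hwv | hwv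
        · obtain ⟨h1, h2⟩ := hwl (u, v) (by simp) hwv
          exact ((hlJ w).2 ⟨⟨hwA, hwv, h1, h2⟩, fun x hx hxw => hwJ x hx.1 hxw,
            fun p hp => hwl p (List.mem_cons_of_mem _ hp)⟩).1
        -- From `v` on nothing is forbidden by the recorded edges, and none is needed: a least
        -- neighbour in `J` after `w` would be an element of `B` larger than `v`.
        · by_contra hn
          obtain ⟨x, hxJ, hwx, hx⟩ := hleast w hwA hn
          rcases lt_trichotomy x w with h | h | h
          · exact hwJ x hxJ h hwx
          · exact hwx.ne h.symm
          · exact absurd (hv x ⟨hxJ, w, hwA, h, hwx, hx⟩) (not_le.2 (hwv.trans_lt h))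

end SimpleGraph

/-! ### Greedy colour classes and list colourings -/

namespace ListColInstance

variable {k : ℕ} (I : ListColInstance k)

/-- Adjacency of vertices given by their numbers. -/
def AdjNum (a b : ℕ) : Prop := ∃ (ha : a < I.n) (hb : b < I.n), I.G.Adj ⟨a, ha⟩ ⟨b, hb⟩

/-- Membership in a list, with the vertex and the colour given by their numbers. -/
def MemNum (w i : ℕ) : Prop := ∃ (hw : w < I.n) (hi : i < k), (⟨i, hi⟩ : Fin k) ∈ I.L ⟨w, hw⟩

/-- `J i` is the class of colour `i` when the colours are treated in increasing order, each by the
greedy procedure with the edges `(U i j, W i j)`. -/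
def IsGreedy (r : ℕ) (U W : ℕ → ℕ → ℕ) (J : ℕ → ℕ → Prop) : Prop :=
  ∀ i < k, ∀ w < I.n, J i w ↔ (∀ i' < i, ¬ J i' w) ∧ I.MemNum w i ∧
    (∀ x < w, J i x → ¬ I.AdjNum w x) ∧
    ∀ j < r, w < W i j → ¬ I.AdjNum w (U i j) ∧ ¬ I.AdjNum w (W i j)

variable {I}

/-- Soundness for arbitrary pairs `U`, `W`: a vertex enters a class only if the colour is in its
list and no smaller member is adjacent. Forbidding more vertices cannot spoil this. -/
theorem IsGreedy.isYes {r : ℕ} {U W : ℕ → ℕ → ℕ} {J : ℕ → ℕ → Prop} (h : I.IsGreedy r U W J)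
    (hJ : ∀ w < I.n, ∃ i < k, J i w) : I.IsYes := by
  choose c hc hcJ using fun w : Fin I.n => hJ w w.2
  have key : ∀ u w : Fin I.n, u < w → I.G.Adj u w → c u ≠ c w := by
    intro u w huw hadj hcu
    refine ((h (c w) (hc w) w w.2).1 (hcJ w)).2.2.1 u huw (hcu ▸ hcJ u) ⟨w.2, u.2, hadj.symm⟩
  refine ⟨SimpleGraph.Coloring.mk (fun w => ⟨c w, hc w⟩) ?_, ?_⟩
  · intro u w hadj heq
    have heq : c u = c w := by simpa using heq
    rcases lt_trichotomy u w with h' | h' | h'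
    · exact key u w h' hadj heq
    · exact hadj.ne h'
    · exact key w u h' hadj.symm heq.symm
  · intro w
    exact ((h (c w) (hc w) w w.2).1 (hcJ w)).2.1.2.2

/-- The decision on `(i, w)` depends only on decisions on `(i', w)` with `i' < i` and `(i, x)` with
`x < w`, so a double strong induction applies. -/
theorem IsGreedy.unique {r : ℕ} {U W : ℕ → ℕ → ℕ} {J J' : ℕ → ℕ → Prop} (h : I.IsGreedy r U W J)
    (h' : I.IsGreedy r U W J') : ∀ i < k, ∀ w < I.n, J i w ↔ J' i w := by
  intro i
  induction i using Nat.strong_induction_on with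
  | _ i ihi =>
  intro hi w
  induction w using Nat.strong_induction_on with
  | _ w ihw =>
  intro hw
  rw [h i hi w hw, h' i hi w hw]
  refine and_congr (forall₂_congr fun i' hi' => ?_) (and_congr Iff.rfl (and_congr
    (forall₂_congr fun x hx => ?_) Iff.rfl))
  · rw [ihi i' hi' (hi'.trans hi) w hw]
  · rw [ihw x hx (hx.trans hw)]

/-- Completeness: the classes of a colouring with least colour sum are maximal independent among the
vertices still available, hence greedy for suitable edges. By uniqueness, any run with these edges
reproduces them. -/
theorem IsYes.exists_edges {r : ℕ} (h : I.IsYes) (hG : IsSP2Free (r + 1) I.G) :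
    ∃ U W : ℕ → ℕ → ℕ, (0 < I.n → ∀ i j, U i j < I.n ∧ W i j < I.n) ∧
      ∀ J, I.IsGreedy r U W J → ∀ w < I.n, ∃ i < k, J i w := by
  classical
  -- a list colouring with the least sum of colours
  obtain ⟨c, hc, hmin⟩ := Set.exists_min_image {c : I.G.Coloring (Fin k) | ∀ u, c u ∈ I.L u}
    (fun c => ∑ u, (c u).val) (Set.toFinite _) h
  have hl : ∀ i : ℕ, i < k → ∃ l : List (Fin I.n × Fin I.n), l.length ≤ r ∧
      ∀ w, (c w).val = i ↔ (i ≤ (c w).val ∧ I.MemNum w i) ∧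
        (∀ x, (c x).val = i → x < w → ¬ I.G.Adj w x) ∧
        ∀ p ∈ l, w < p.2 → ¬ I.G.Adj w p.1 ∧ ¬ I.G.Adj w p.2 := by
    intro i hi
    obtain ⟨l, hl, _, hlJ⟩ := (hG.noInducedMatching
      {w | i ≤ (c w).val ∧ I.MemNum w i}).exists_edges (J := {w | (c w).val = i})
      (by
        rintro w rfl
        exact ⟨le_rfl, w.2, hi, hc w⟩)
      (by
        intro x hx y hy hxy
        exact c.valid hxy (Fin.ext (Eq.trans hx (Eq.symm hy))))
      (by
        rintro w ⟨hiw, _, _, hwL⟩ hwi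
        by_contra! hno
        -- Recolouring `w` with `i` is proper, as `w` has no neighbour of colour `i`, and it lowers
        -- the sum of colours.
        let c' : I.G.Coloring (Fin k) := SimpleGraph.Coloring.mk
          (Function.update c w ⟨i, hi⟩) (by
            intro x y hxy
            simp only [Function.update_apply]
            split_ifs with h1 h2 h2
            · exact absurd (h1.trans h2.symm) hxy.ne
            · subst h1
              exact fun h => hno y (by simp [← h]) hxy
            · subst h2
              exact fun h => hno x (by simp [h]) hxy.symm
            · exact c.valid hxy)
        have hc' : ∀ u, c' u = Function.update c w ⟨i, hi⟩ u := fun _ => rfl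
        have hle := hmin c' (by
          intro u
          rw [hc', Function.update_apply]
          split_ifs with hu
          · subst hu; exact hwL
          · exact hc u)
        refine absurd hle (not_le.2 (Finset.sum_lt_sum ?_ ⟨w, Finset.mem_univ _, ?_⟩))
        · intro u _
          rw [hc', Function.update_apply]
          split_ifs with hu
          · subst hu; exact hiw
          · exact le_rfl
        · rw [hc', Function.update_self]
          exact lt_of_le_of_ne hiw (Ne.symm hwi))
    exact ⟨l, hl, hlJ⟩
  choose! l hlr hlw using hl
  -- Lists shorter than `r` are padded with vertex `0`. A second end `0` forbids nothing, since no
  -- vertex is below it.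
  refine ⟨fun i j => ((l i)[j]?.map fun p => p.1.val).getD 0,
    fun i j => ((l i)[j]?.map fun p => p.2.val).getD 0, ?_, ?_⟩
  · intro hn i j
    beta_reduce
    cases (l i)[j]? with
    | none => exact ⟨hn, hn⟩
    | some p => exact ⟨p.1.2, p.2.2⟩
  · intro J hJ w hw
    refine ⟨c ⟨w, hw⟩, (c ⟨w, hw⟩).2, ?_⟩
    refine (hJ.unique (J' := fun i w => ∃ hw : w < I.n, (c ⟨w, hw⟩).val = i) ?_ _ (c ⟨w, hw⟩).2 w
      hw).2 ⟨hw, rfl⟩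
    intro i hi w hw
    have h1 : (∃ hw : w < I.n, (c ⟨w, hw⟩).val = i) ↔ (c ⟨w, hw⟩).val = i := ⟨fun ⟨_, h⟩ => h,
      fun h => ⟨hw, h⟩⟩
    beta_reduce
    rw [h1, hlw i hi]
    constructor
    · rintro ⟨⟨hiw, hL⟩, hx, hp⟩
      refine ⟨fun i' hi' ⟨_, h⟩ => by omega, hL, fun x hxw ⟨hxn, hxi⟩ ⟨_, _, hadj⟩ =>
        hx _ hxi hxw hadj, fun j hj hwj => ?_⟩
      cases hlj : (l i)[j]? with
      | none => simp [hlj] at hwj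
      | some p =>
        simp only [hlj, Option.map_some, Option.getD_some] at hwj ⊢
        have := hp p (List.mem_of_getElem? hlj) hwj
        exact ⟨fun ⟨_, _, h⟩ => this.1 h, fun ⟨_, _, h⟩ => this.2 h⟩
    · rintro ⟨hi', hL, hx, hp⟩
      refine ⟨⟨?_, hL⟩, fun x hxi hxw hadj => hx x hxw ⟨x.2, hxi⟩ ⟨hw, x.2, hadj⟩,
        fun p hpl hwp => ?_⟩
      · by_contra hlt
        exact hi' _ (not_le.1 hlt) ⟨hw, rfl⟩
      · obtain ⟨j, hj, rfl⟩ := List.getElem_of_mem hpl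
        have hwp' : w < (l i)[j].2.val := hwp
        have := hp j (hj.trans_le (hlr i hi)) (by simpa [hj] using hwp')
        simp only [List.getElem?_eq_getElem hj, Option.map_some, Option.getD_some] at this
        exact ⟨fun h => this.1 ⟨hw, _, h⟩, fun h => this.2 ⟨hw, _, h⟩⟩

end ListColInstance

/-! ### Digits of certificates and positions in the input word -/

theorem Nat.exists_digits {n : ℕ} (hn : 0 < n) (q : ℕ) (d : ℕ → ℕ) (hd : ∀ p, d p < n) :
    ∃ c < n ^ q, ∀ p < q, c / n ^ p % n = d p := by
  induction q generalizing d with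
  | zero => exact ⟨0, by simp, by simp⟩
  | succ q ih =>
    obtain ⟨c, hc, hcd⟩ := ih (fun p => d (p + 1)) fun p => hd _
    refine ⟨d 0 + n * c, ?_, fun p hp => ?_⟩
    · have := hd 0
      rw [pow_succ]
      nlinarith
    · cases p with
      | zero => simp [Nat.add_mul_mod_self_left, Nat.mod_eq_of_lt (hd 0)]
      | succ p =>
        rw [pow_succ', ← Nat.div_div_eq_div_mul, Nat.add_mul_div_left _ _ hn,
          Nat.div_eq_of_lt (hd 0), Nat.zero_add]
        exact hcd p (by omega)

theorem List.getElem?_flatMap_of_length {α β : Type} {f : α → List β} {m : ℕ}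
    (hf : ∀ a, (f a).length = m) (l : List α) (i j : ℕ) (hj : j < m) :
    (l.flatMap f)[i * m + j]? = l[i]?.bind fun a => (f a)[j]? := by
  induction l generalizing i with
  | nil => simp
  | cons a l ih =>
    rw [List.flatMap_cons]
    cases i with
    | zero =>
      rw [Nat.zero_mul, Nat.zero_add, List.getElem?_append_left (by rw [hf]; exact hj)]
      simp
    | succ i =>
      have h : (i + 1) * m + j = m + (i * m + j) := by ring
      rw [h, List.getElem?_append_right (by rw [hf]; omega), hf, Nat.add_sub_cancel_left, ih]
      simp

theorem List.sum_range_eq_count {α : Type} [DecidableEq α] (l : List α) (a : α) :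
    ∑ x ∈ Finset.range l.length, (if l[x]? = some a then 1 else 0) = l.count a := by
  induction l with
  | nil => simp
  | cons b l ih =>
    rw [List.length_cons, Finset.sum_range_succ', List.count_cons]
    simp [ih]

namespace ListColInstance

variable {k : ℕ} (I : ListColInstance k)

open Classical in
/-- The part of the input word that belongs to the vertex `u`. -/
noncomputable def block (u : Fin I.n) : List Γ' :=
  [Γ'.bra] ++ (List.finRange I.n).map (fun v => Γ'.bit (decide (I.G.Adj u v))) ++ [Γ'.comma]
    ++ (List.finRange k).map (fun i => Γ'.bit (decide (i ∈ I.L u))) ++ [Γ'.ket]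

theorem encode_eq : I.encode = (List.finRange I.n).flatMap I.block := rfl

theorem length_block (u : Fin I.n) : (I.block u).length = I.n + k + 3 := by
  simp [block]; omega

theorem length_encode : I.encode.length = I.n * (I.n + k + 3) := by
  simp [encode_eq, List.length_flatMap, length_block]

theorem count_bra_encode : I.encode.count Γ'.bra = I.n := by
  have h : ∀ u, (I.block u).count Γ'.bra = 1 := by
    intro u
    simp [block, List.count_eq_zero]
  rw [encode_eq, List.count_flatMap]
  simp [Function.comp_def, h]

theorem getElem?_encode {u : ℕ} (hu : u < I.n) {j : ℕ} (hj : j < I.n + k + 3) :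
    I.encode[u * (I.n + k + 3) + j]? = (I.block ⟨u, hu⟩)[j]? := by
  rw [encode_eq, List.getElem?_flatMap_of_length I.length_block _ _ _ hj]
  simp [hu]

/-- A block has length `n + k + 3`; the offset 1 skips its opening bracket. -/
theorem getElem?_encode_adj {u v : ℕ} (hu : u < I.n) (hv : v < I.n) :
    I.encode[u * (I.n + k + 3) + 1 + v]? = some (Γ'.bit true) ↔ I.AdjNum u v := by
  classical
  have h : (I.block ⟨u, hu⟩)[1 + v]? =
      some (Γ'.bit (decide (I.G.Adj ⟨u, hu⟩ ⟨v, hv⟩))) := by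
    simp only [block, List.append_assoc]
    rw [List.getElem?_append_right (by simp), List.getElem?_append_left (by simp [hv])]
    simp [hv]
  rw [Nat.add_assoc, I.getElem?_encode hu (by omega), h]
  simp [AdjNum, hu, hv]

/-- The offset `n + 2` skips the bracket, the matrix row and the comma. -/
theorem getElem?_encode_mem {u i : ℕ} (hu : u < I.n) (hi : i < k) :
    I.encode[u * (I.n + k + 3) + (I.n + 2) + i]? = some (Γ'.bit true) ↔ I.MemNum u i := by
  classical
  have h : (I.block ⟨u, hu⟩)[I.n + 2 + i]? =
      some (Γ'.bit (decide ((⟨i, hi⟩ : Fin k) ∈ I.L ⟨u, hu⟩))) := by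
    simp only [block, List.append_assoc]
    rw [List.getElem?_append_right (by simp; omega), List.getElem?_append_right (by simp; omega),
      List.getElem?_append_right (by simp; omega), List.getElem?_append_left (by simp; omega)]
    simp only [List.length_cons, List.length_nil, List.length_map, List.length_finRange]
    have : I.n + 2 + i - (0 + 1) - I.n - (0 + 1) = i := by omega
    rw [this]
    simp [hi]
  rw [Nat.add_assoc, I.getElem?_encode hu (by omega), h]
  simp [MemNum, hu, hi]

end ListColInstance

/-! ### The search algorithm as an expression -/

namespace NatExpr

/-- In the following expressions, `h` is the number of bits that were prepended to the input word,
`n` the number of vertices and `k` the number of colours. -/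
def adjE (h n k a b : NatExpr) : NatExpr :=
  read (Γ'.bit true) (add h (add (add (mul a (add (add n k) (const 3))) (const 1)) b))

def memE (h n k a i : NatExpr) : NatExpr :=
  read (Γ'.bit true) (add h (add (add (mul a (add (add n k) (const 3))) (add n (const 2))) i))

/-- The bit that was prepended after `p` others. -/
def bitE (h p : NatExpr) : NatExpr := read (Γ'.bit true) (sub (sub h (const 1)) p)

/-- The `p`-th digit of `c` in base `n`. -/
def digitE (c n p : NatExpr) : NatExpr := mod (shift c n p) n

/-- Every vertex contributes exactly one opening bracket to the word. -/
def vertexCountE : NatExpr := sum len (read Γ'.bra (var 0))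

/-- environment: number of vertices -/
def colourCountE : NatExpr := sub (sub (div len (var 0)) (var 0)) (const 3)

/-- environment: numbers of colours and vertices -/
def certificateCountE (r : ℕ) : NatExpr := pow (var 1) (mul (const (2 * r)) (var 0))

/-- Environment: index `j` of the edge, followed by that of `choiceE`. Digits `2 * (i * r + j)` and
its successor, in base `n`, are the two ends of edge `j` for colour `i`. -/
def firstEndE (r : ℕ) : NatExpr :=
  digitE (var 4) (var 7) (mul (const 2) (add (mul (var 2) (const r)) (var 0)))

def secondEndE (r : ℕ) : NatExpr :=
  digitE (var 4) (var 7) (succ (mul (const 2) (add (mul (var 2) (const r)) (var 0))))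

/-- Whether vertex `w` gets colour `i`;
environment: `w`, `i`, number of bits prepended, certificate, number of certificates, `k`, `n` -/
def choiceE (r : ℕ) : NatExpr :=
  mul
    (mul (not (sum (var 1) (bitE (var 3) (add (mul (var 0) (var 7)) (var 1)))))
      (memE (var 2) (var 6) (var 5) (var 0) (var 1)))
    (mul
      (not (sum (var 0) (mul (bitE (var 3) (add (mul (var 2) (var 7)) (var 0)))
        (adjE (var 3) (var 7) (var 6) (var 1) (var 0)))))
      (not (sum (const r) (mul (lt (var 1) (secondEndE r))
        (add (adjE (var 3) (var 7) (var 6) (var 1) (firstEndE r))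
          (adjE (var 3) (var 7) (var 6) (var 1) (secondEndE r)))))))

/-- environment: number of bits prepended, certificate, number of certificates, `k`, `n` -/
def stepE (r : ℕ) : NatExpr :=
  letIn (div (var 0) (var 4)) (letIn (mod (var 1) (var 5)) (choiceE r))

/-- Whether all vertices are coloured;
environment: certificate, number of certificates, `k`, `n` -/
def coveredE : NatExpr :=
  not (sum (var 3) (not (sum (var 3)
    (bitE (mul (var 4) (var 5)) (add (mul (var 0) (var 5)) (var 1))))))

/-- environment: number of certificates, `k`, `n` -/
def searchE (r : ℕ) : NatExpr :=
  lt zero (sum (var 0) (build (mul (var 2) (var 3)) (stepE r) coveredE))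

/-- The algorithm for List Colouring on `(r + 1)P₂`-free graphs. -/
def listColouringE (r : ℕ) : NatExpr :=
  letIn vertexCountE (letIn colourCountE (letIn (certificateCountE r) (searchE r)))

section eval

variable {k : ℕ} {I : ListColInstance k} {env : List ℕ} {T : List Γ'} {m : ℕ} {t : ℕ → Bool}
  {h n kE a b : NatExpr}

open Classical in
theorem eval_adjE {u v : ℕ} (hT : ∀ q, T[m + q]? = I.encode[q]?) (hh : eval h env T = m)
    (hn : eval n env T = I.n) (hk : eval kE env T = k) (ha : eval a env T = u)
    (hb : eval b env T = v) (hu : u < I.n) (hv : v < I.n) :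
    eval (adjE h n kE a b) env T = if I.AdjNum u v then 1 else 0 := by
  simp only [adjE, eval, eval_add, eval_mul, eval_const, hh, hn, hk, ha, hb, hT,
    I.getElem?_encode_adj hu hv]

open Classical in
theorem eval_memE {u i : ℕ} (hT : ∀ q, T[m + q]? = I.encode[q]?) (hh : eval h env T = m)
    (hn : eval n env T = I.n) (hk : eval kE env T = k) (ha : eval a env T = u)
    (hb : eval b env T = i) (hu : u < I.n) (hi : i < k) :
    eval (memE h n kE a b) env T = if I.MemNum u i then 1 else 0 := by
  simp only [memE, eval, eval_add, eval_mul, eval_const, hh, hn, hk, ha, hb, hT,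
    I.getElem?_encode_mem hu hi]

theorem eval_bitE {p : ℕ} (hT : ∀ p < m, T[m - 1 - p]? = some (Γ'.bit (t p)))
    (hh : eval h env T = m) (ha : eval a env T = p) (hp : p < m) :
    eval (bitE h a) env T = if t p then 1 else 0 := by
  simp only [bitE, eval, eval_sub, eval_const, hh, ha, hT _ hp]
  simp

theorem eval_digitE (hn : eval n env T ≠ 0) :
    eval (digitE h n a) env T = eval h env T / eval n env T ^ eval a env T % eval n env T := by
  rw [digitE, eval_mod _ _ _ _ hn, eval_shift _ _ _ _ _ hn]

end eval

end NatExpr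

/-! ### Correctness of the search -/

namespace NatExpr

theorem eval_not_ne_zero (a : NatExpr) (env : List ℕ) (T : List Γ') :
    eval (not a) env T ≠ 0 ↔ eval a env T = 0 := by
  rw [eval_not]; split_ifs with h <;> simp [h]

theorem eval_sum_eq_zero (n f : NatExpr) (env : List ℕ) (T : List Γ') :
    eval (sum n f) env T = 0 ↔ ∀ x < eval n env T, eval f (x :: env) T = 0 := by
  rw [eval_sum, Finset.sum_eq_zero_iff]
  simp

section

variable {k : ℕ} {I : ListColInstance k} {T : List Γ'} {t : ℕ → Bool} {r w i m c N : ℕ}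

theorem eval_firstEndE (hn : I.n ≠ 0) (j : ℕ) :
    eval (firstEndE r) (j :: w :: i :: m :: c :: N :: k :: I.n :: []) T =
      c / I.n ^ (2 * (i * r + j)) % I.n := by
  rw [firstEndE, eval_digitE (by simpa using hn)]
  simp

theorem eval_secondEndE (hn : I.n ≠ 0) (j : ℕ) :
    eval (secondEndE r) (j :: w :: i :: m :: c :: N :: k :: I.n :: []) T =
      c / I.n ^ (2 * (i * r + j) + 1) % I.n := by
  rw [secondEndE, eval_digitE (by simpa using hn)]
  simp [eval.eq_3]

/-- Decisions are ordered by colour and then by vertex, so `i' * n + w` for `i' < i` and `i * n + x`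
for `x < w` are below `m = i * n + w`: all earlier decisions needed are already in the word. -/
theorem eval_choiceE (hm : m = i * I.n + w) (hw : w < I.n) (hi : i < k)
    (hT : ∀ q, T[m + q]? = I.encode[q]?)
    (ht : ∀ p < m, T[m - 1 - p]? = some (Γ'.bit (t p))) :
    eval (choiceE r) (w :: i :: m :: c :: N :: k :: I.n :: []) T ≠ 0 ↔
      (∀ i' < i, ¬ t (i' * I.n + w)) ∧ I.MemNum w i ∧
      (∀ x < w, t (i * I.n + x) → ¬ I.AdjNum w x) ∧
      ∀ j < r, w < c / I.n ^ (2 * (i * r + j) + 1) % I.n →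
        ¬ I.AdjNum w (c / I.n ^ (2 * (i * r + j)) % I.n) ∧
        ¬ I.AdjNum w (c / I.n ^ (2 * (i * r + j) + 1) % I.n) := by
  classical
  have hn : I.n ≠ 0 := by omega
  have hmod : ∀ x, x % I.n < I.n := fun x => Nat.mod_lt _ (by omega)
  simp only [choiceE, eval_mul, mul_ne_zero_iff, eval_not_ne_zero, eval_sum_eq_zero, and_assoc]
  refine and_congr (forall₂_congr fun x hx => ?_) (and_congr ?_
    (and_congr (forall₂_congr fun x hx => ?_) (forall_congr' fun j => ?_)))
  · have hx : x < i := hx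
    have : x * I.n + w < m := by
      have := Nat.mul_le_mul_right I.n (Nat.succ_le_of_lt hx)
      rw [Nat.succ_mul] at this
      omega
    rw [eval_bitE ht (by rfl) (by simp) this]
    simp
  · rw [eval_memE hT (by rfl) (by rfl) (by rfl) (by rfl) (by rfl) hw hi]
    simp
  · have hx : x < w := hx
    rw [eval_bitE (p := i * I.n + x) ht (by rfl) (by simp) (by omega),
      eval_adjE hT (by rfl) (by rfl) (by rfl) (by rfl) (by rfl) hw (hx.trans hw)]
    cases t (i * I.n + x) <;> simp
  · rw [eval_const]
    refine imp_congr_right fun hj => ?_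
    have hlt : eval (lt (var 1) (secondEndE r)) (j :: w :: i :: m :: c :: N :: k :: I.n :: []) T =
        if w < c / I.n ^ (2 * (i * r + j) + 1) % I.n then 1 else 0 := by
      rw [eval_lt, eval_secondEndE hn]; rfl
    rw [hlt, eval_add,
      eval_adjE hT (by rfl) (by rfl) (by rfl) (by rfl) (eval_firstEndE hn j) hw (hmod _),
      eval_adjE hT (by rfl) (by rfl) (by rfl) (by rfl) (eval_secondEndE hn j) hw (hmod _)]
    split_ifs <;> simp_all

theorem eval_stepE (hmk : m < k * I.n)
    (hT : ∀ q, T[m + q]? = I.encode[q]?)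
    (ht : ∀ p < m, T[m - 1 - p]? = some (Γ'.bit (t p))) :
    eval (stepE r) (m :: c :: N :: k :: I.n :: []) T ≠ 0 ↔
      (∀ i' < m / I.n, ¬ t (i' * I.n + m % I.n)) ∧ I.MemNum (m % I.n) (m / I.n) ∧
      (∀ x < m % I.n, t (m / I.n * I.n + x) → ¬ I.AdjNum (m % I.n) x) ∧
      ∀ j < r, m % I.n < c / I.n ^ (2 * (m / I.n * r + j) + 1) % I.n →
        ¬ I.AdjNum (m % I.n) (c / I.n ^ (2 * (m / I.n * r + j)) % I.n) ∧
        ¬ I.AdjNum (m % I.n) (c / I.n ^ (2 * (m / I.n * r + j) + 1) % I.n) := by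
  have hn : I.n ≠ 0 := by rintro h; rw [h] at hmk; omega
  rw [← eval_choiceE (N := N) (Nat.div_add_mod' m I.n).symm (Nat.mod_lt _ (by omega))
    ((Nat.div_lt_iff_lt_mul (by omega)).2 hmk) hT ht, stepE, eval_letIn, eval_letIn,
    eval_div _ _ _ _ (by simpa using hn), eval_mod _ _ _ _ (by simpa using hn)]
  rfl

/-- The bits that the search prepends to the input word for the certificate `c`. -/
def history (I : ListColInstance k) (r c N : ℕ) (w : List Γ') : ℕ → List Γ' :=
  recVal w fun x H =>
    Γ'.bit (decide (eval (stepE r) (x :: c :: N :: k :: I.n :: []) H ≠ 0)) :: H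

theorem history_add (q : ℕ) (w : List Γ') : (history I r c N w m)[m + q]? = w[q]? := by
  induction m with
  | zero => simp [history, recVal]
  | succ m ih =>
    rw [Nat.add_right_comm, history, recVal, List.getElem?_cons_succ]
    exact ih

theorem history_bit (w : List Γ') {p : ℕ} (hp : p < m) : (history I r c N w m)[m - 1 - p]? =
    some (Γ'.bit (decide (eval (stepE r) (p :: c :: N :: k :: I.n :: [])
      (history I r c N w p) ≠ 0))) := by
  induction m with
  | zero => omega
  | succ m ih =>
    rw [history, recVal]
    rcases Nat.lt_succ_iff_lt_or_eq.1 hp with hp | rfl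
    · obtain ⟨x, hx⟩ : ∃ x, m + 1 - 1 - p = x + 1 := ⟨m - 1 - p, by omega⟩
      rw [hx, List.getElem?_cons_succ]
      have : x = m - 1 - p := by omega
      rw [this]
      exact ih hp
    · rw [Nat.add_sub_cancel, Nat.sub_self]
      rfl

/-- Whether vertex `w` gets colour `i` for the certificate `c`. -/
def Chosen (I : ListColInstance k) (r c N i w : ℕ) : Prop :=
  eval (stepE r) ((i * I.n + w) :: c :: N :: k :: I.n :: [])
    (history I r c N I.encode (i * I.n + w)) ≠ 0

/-- Bits are only ever prepended, so the bit found later for position `p` is the decision made at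
round `p`. The bits thus satisfy the greedy recursion for the pairs given by the digits of `c`. -/
theorem isGreedy_chosen (I : ListColInstance k) (r c N : ℕ) :
    I.IsGreedy r (fun i j => c / I.n ^ (2 * (i * r + j)) % I.n)
      (fun i j => c / I.n ^ (2 * (i * r + j) + 1) % I.n) (Chosen I r c N) := by
  intro i hi w hw
  have h := eval_stepE (I := I) (r := r) (c := c) (N := N) (m := i * I.n + w)
    (T := history I r c N I.encode (i * I.n + w))
    (t := fun p => decide (eval (stepE r) (p :: c :: N :: k :: I.n :: [])
      (history I r c N I.encode p) ≠ 0))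
    (by
      have := Nat.mul_le_mul_right I.n (Nat.succ_le_of_lt hi)
      rw [Nat.succ_mul] at this
      omega)
    (fun q => history_add q _) (fun p hp => history_bit _ hp)
  have hdiv : (i * I.n + w) / I.n = i := by
    rw [Nat.add_comm, Nat.add_mul_div_right _ _ (by omega), Nat.div_eq_of_lt hw, Nat.zero_add]
  have hmod : (i * I.n + w) % I.n = w := by
    rw [Nat.add_comm, Nat.add_mul_mod_self_right, Nat.mod_eq_of_lt hw]
  rw [hdiv, hmod] at h
  simp only [decide_eq_true_eq] at h
  exact h

theorem eval_searchE_le (env : List ℕ) : eval (searchE r) env T ≤ 1 := by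
  rw [searchE, eval_lt]; split_ifs <;> simp

theorem eval_searchE_ne_zero :
    eval (searchE r) (N :: k :: I.n :: []) I.encode ≠ 0 ↔
      ∃ c < N, ∀ w < I.n, ∃ i < k, Chosen I r c N i w := by
  classical
  have h0 : ∀ a : NatExpr, eval (lt zero a) (N :: k :: I.n :: []) I.encode ≠ 0 ↔
      ¬ eval a (N :: k :: I.n :: []) I.encode = 0 := by
    intro a
    rw [eval_lt]
    change (if 0 < _ then 1 else 0) ≠ 0 ↔ _
    by_cases h : eval a (N :: k :: I.n :: []) I.encode = 0
    · simp [h]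
    · simp [h, Nat.pos_of_ne_zero h]
  rw [searchE, h0, eval_sum_eq_zero]
  push Not
  refine exists_congr fun c => and_congr Iff.rfl ?_
  have hb : eval (build (mul (var 2) (var 3)) (stepE r) coveredE) (c :: N :: k :: I.n :: [])
      I.encode = eval coveredE (c :: N :: k :: I.n :: [])
        (history I r c N I.encode (k * I.n)) := by
    rw [eval, eval_mul]; rfl
  rw [hb, coveredE, eval_not_ne_zero, eval_sum_eq_zero]
  refine forall₂_congr fun w hw => ?_
  have hw : w < I.n := hw
  rw [← not_iff_not, ← ne_eq, eval_not_ne_zero, eval_sum_eq_zero]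
  push Not
  refine forall₂_congr fun i hi => ?_
  have hi : i < k := hi
  have : i * I.n + w < k * I.n := by
    have := Nat.mul_le_mul_right I.n (Nat.succ_le_of_lt hi)
    rw [Nat.succ_mul] at this
    omega
  rw [eval_bitE (m := k * I.n) (t := fun p => decide (eval (stepE r) (p :: c :: N :: k :: I.n :: [])
    (history I r c N I.encode p) ≠ 0)) (fun p hp => history_bit _ hp) (by simp)
    (by simp) this]
  simp [Chosen]

theorem eval_vertexCountE : eval vertexCountE [] I.encode = I.n := by
  rw [vertexCountE, eval_sum]
  exact (List.sum_range_eq_count _ _).trans I.count_bra_encode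

/-- The word has length `n * (n + k + 3)`. -/
theorem eval_colourCountE (hn : I.n ≠ 0) : eval colourCountE [I.n] I.encode = k := by
  simp only [colourCountE, eval_sub, eval_const]
  rw [eval_div _ _ _ _ (by simpa using hn)]
  simp only [eval_var_zero, eval.eq_8, I.length_encode]
  rw [Nat.mul_div_cancel_left _ (by omega)]
  omega

theorem eval_listColouringE_le (w : List Γ') : eval (listColouringE r) [] w ≤ 1 := by
  simp only [listColouringE, eval_letIn]
  exact eval_searchE_le _

theorem eval_listColouringE (hG : IsSP2Free (r + 1) I.G) :
    eval (listColouringE r) [] I.encode ≠ 0 ↔ I.IsYes := by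
  simp only [listColouringE, eval_letIn, eval_vertexCountE]
  rcases Nat.eq_zero_or_pos I.n with h0 | hn
  · obtain ⟨n, G, L⟩ := I
    obtain rfl : n = 0 := h0
    -- Without vertices the word is empty and does not reveal `k`. The algorithm then computes `0`
    -- colours and `0 ^ 0 = 1` certificate, which vacuously covers everything; the correct answer is
    -- yes.
    have e1 : (⟨0, G, L⟩ : ListColInstance k).encode =
        (⟨0, ⊥, fun u => u.elim0⟩ : ListColInstance 0).encode := rfl
    have e2 : eval colourCountE [0] (⟨0, ⊥, fun u => u.elim0⟩ : ListColInstance 0).encode = 0 := rfl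
    rw [e1]
    simp only [e2]
    refine iff_of_true ((eval_searchE_ne_zero (I := (⟨0, ⊥, fun u => u.elim0⟩ :
      ListColInstance 0))).2 ⟨0, ?_, fun w hw => absurd hw (Nat.not_lt_zero w)⟩)
      ⟨SimpleGraph.Coloring.mk (fun u => u.elim0) fun {u} => u.elim0, fun u => u.elim0⟩
    simp [certificateCountE]
  · rw [eval_colourCountE hn.ne', certificateCountE, eval_pow]
    simp only [eval_mul, eval_const, eval_var_zero, eval_var_succ]
    rw [eval_searchE_ne_zero]
    constructor
    · rintro ⟨c, _, hc⟩
      exact (isGreedy_chosen I r c _).isYes hc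
    · intro h
      obtain ⟨U, W, hUW, hJ⟩ := h.exists_edges hG
      have hUW := hUW hn
      -- Even digits hold the first ends and odd digits the second ends; `p / 2 = i * r + j`
      -- determines the colour and the index of the edge.
      obtain ⟨c, hc, hcd⟩ := Nat.exists_digits hn (2 * r * k)
        (fun p => if p % 2 = 0 then U (p / 2 / r) (p / 2 % r) else W (p / 2 / r) (p / 2 % r))
        (fun p => by split_ifs; exacts [(hUW _ _).1, (hUW _ _).2])
      refine ⟨c, hc, hJ _ fun i hi w hw => ?_⟩
      rw [isGreedy_chosen I r c _ i hi w hw]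
      refine and_congr Iff.rfl (and_congr Iff.rfl (and_congr Iff.rfl
        (forall₂_congr fun j hj => ?_)))
      have hlt : i * r + j < k * r := by
        have := Nat.mul_le_mul_right r (Nat.succ_le_of_lt hi)
        rw [Nat.succ_mul] at this
        omega
      have hkr : 2 * r * k = 2 * (k * r) := by ring
      have hdiv : (i * r + j) / r = i := by
        rw [Nat.add_comm, Nat.add_mul_div_right _ _ (by omega), Nat.div_eq_of_lt hj,
          Nat.zero_add]
      have hmod : (i * r + j) % r = j := by
        rw [Nat.add_comm, Nat.add_mul_mod_self_right, Nat.mod_eq_of_lt hj]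
      have h1 := hcd (2 * (i * r + j)) (by omega)
      have h2 := hcd (2 * (i * r + j) + 1) (by omega)
      have e1 : 2 * (i * r + j) / 2 = i * r + j := by omega
      have e2 : (2 * (i * r + j) + 1) / 2 = i * r + j := by omega
      have e3 : 2 * (i * r + j) % 2 = 0 := by omega
      have e4 : (2 * (i * r + j) + 1) % 2 ≠ 0 := by omega
      rw [if_pos e3, e1, hdiv, hmod] at h1
      rw [if_neg e4, e2, hdiv, hmod] at h2
      beta_reduce
      rw [h1, h2]

end

end NatExpr

/-! ### Running time and conclusion -/

namespace NatExpr

/-- The number of certificates is an entry of the environment here, so running through all of them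
counts as polynomial. -/
theorem isPoly_searchE (r : ℕ) : IsPoly (searchE r) := by
  unfold searchE stepE coveredE choiceE secondEndE firstEndE digitE bitE memE adjE
  repeat with_reducible first
    | apply IsPoly.var | apply IsPoly.zero | apply IsPoly.const | apply IsPoly.succ
    | apply IsPoly.len | apply IsPoly.not | apply IsPoly.lt | apply IsPoly.mul
    | apply IsPoly.sum | apply IsPoly.read | apply IsPoly.build | apply IsPoly.add
    | apply IsPoly.sub | apply IsPoly.mod | apply IsPoly.div | apply IsPoly.shift
    | apply IsPoly.letIn

/-- The instances with at least one vertex and one colour. -/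
abbrev _root_.ListColInstance.Nondegenerate : Type :=
  {p : Σ k, ListColInstance k // 0 < p.1 ∧ 0 < p.2.n}

/-- A bound on the numbers the algorithm for `(r + 1)P₂`-free graphs handles. -/
def sizeBound (r : ℕ) (x : ListColInstance.Nondegenerate) : ℕ :=
  5 * (x.1.1 * x.1.2.n) ^ ((2 * r + 2) * x.1.1)

/-- Of the exponent, `2 * r * k` pays for the number of certificates; the remaining `2 * k ≥ 2`
leaves room for the word length, which is at most `5 * (k * n) ^ 2`. -/
theorem le_sizeBound (r : ℕ) (x : ListColInstance.Nondegenerate) :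
    2 ≤ sizeBound r x ∧ x.1.1 ≤ sizeBound r x ∧ x.1.2.n ≤ sizeBound r x ∧
      x.1.2.n ^ (2 * r * x.1.1) ≤ sizeBound r x ∧ x.1.2.encode.length ≤ sizeBound r x := by
  obtain ⟨⟨k, I⟩, hk, hn⟩ := x
  simp only [sizeBound, I.length_encode] at *
  set n := I.n
  have h1 : 1 ≤ k * n := Nat.mul_pos hk hn
  have h2 : k ≤ k * n := Nat.le_mul_of_pos_right _ hn
  have h3 : n ≤ k * n := Nat.le_mul_of_pos_left _ hk
  have h4 : (k * n) ^ 2 ≤ (k * n) ^ ((2 * r + 2) * k) := Nat.pow_le_pow_right h1 (by nlinarith)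
  have h5 : k * n ≤ (k * n) ^ 2 := Nat.le_self_pow (by decide) _
  have h6 : n ^ (2 * r * k) ≤ (k * n) ^ ((2 * r + 2) * k) :=
    (Nat.pow_le_pow_left h3 _).trans (Nat.pow_le_pow_right h1 (by nlinarith))
  have h7 : n * (n + k + 3) ≤ 5 * (k * n) ^ 2 := by nlinarith
  refine ⟨by omega, by omega, by omega, by omega, by omega⟩

theorem polyBdd_cost (r : ℕ) : PolyBdd (sizeBound r) fun x =>
    cost (listColouringE r) [] x.1.2.encode + 2 * x.1.2.encode.length + 3 := by
  have hS := fun x => le_sizeBound r x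
  have h2 := fun x => (hS x).1
  have K := PolyBdd.const (B := sizeBound r) h2
  have self : PolyBdd (sizeBound r) (sizeBound r) := .self
  let φ (env : ListColInstance.Nondegenerate → List ℕ)
      (h : ∀ x, ∀ v ∈ env x, v ≤ sizeBound r x) (x : ListColInstance.Nondegenerate) :
      EvalContext := ⟨env x, x.1.2.encode, sizeBound r x, h2 x, h x, (hS x).2.2.2.2⟩
  have lift {e : NatExpr} (he : IsPoly e) (env : ListColInstance.Nondegenerate → List ℕ)
      (h : ∀ x, ∀ v ∈ env x, v ≤ sizeBound r x) :
      PolyBdd (sizeBound r) fun x => cost e (env x) x.1.2.encode :=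
    PolyBdd.comp (φ := φ env h) he.2 self
  have c1 := lift (IsPoly.len.sum ((IsPoly.var 0).read Γ'.bra)) (fun _ => []) (by simp)
  have c2 := lift (((IsPoly.len.div (.var 0)).sub (.var 0)).sub (.const 3)) (fun x => [x.1.2.n])
    (by intro x v hv; rw [List.mem_singleton.1 hv]; exact (hS x).2.2.1)
  have hkn : ∀ x : ListColInstance.Nondegenerate, ∀ v ∈ [x.1.1, x.1.2.n], v ≤ sizeBound r x := by
    intro x v hv
    simp only [List.mem_cons, List.not_mem_nil, or_false] at hv
    rcases hv with rfl | rfl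
    exacts [(hS x).2.1, (hS x).2.2.1]
  have c3 : PolyBdd (sizeBound r) fun x =>
      cost (certificateCountE r) [x.1.1, x.1.2.n] x.1.2.encode := by
    obtain ⟨c, hc⟩ := ((IsPoly.var 1).mul (((IsPoly.var 1).del 0).del 0)).2
    have ca := lift (IsPoly.const 1) _ hkn
    have cn := lift ((IsPoly.const (2 * r)).mul (IsPoly.var 0)) _ hkn
    have cM : PolyBdd (sizeBound r) fun x => (sizeBound r x + 2 * r * x.1.1) :=
      self.add h2 ((K (2 * r)).mul (self.mono fun x => (hS x).2.1))
    have cMc : PolyBdd (sizeBound r) fun x => (sizeBound r x + 2 * r * x.1.1) ^ c :=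
      PolyBdd.comp (D := id) (h := fun y => y ^ c)
        (φ := fun x => sizeBound r x + 2 * r * x.1.1) ⟨c, fun _ => le_rfl⟩ cM
    refine PolyBdd.mono ((((ca.add h2 cn).add h2 (cM.mul ((cMc.add h2 ((K 4).mul cM)).add h2
      (K 4)))).add h2 ((K 2).mul cM)).add h2 (K 2)) fun x => ?_
    -- The partial products `n ^ i` with `i ≤ 2 * r * k` do not exceed the number of certificates.
    refine cost_fold_le hc ((h2 x).trans (Nat.le_add_right _ _))
      (fun v hv => (hkn x v hv).trans (Nat.le_add_right _ _))
      ((hS x).2.2.2.2.trans (Nat.le_add_right _ _)) (by simp) fun i hi => ?_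
    rw [recVal_pow]
    simp only [eval_mul, eval_const, eval_var_zero, eval_var_succ] at hi ⊢
    exact ((Nat.pow_le_pow_right x.2.2 hi).trans (hS x).2.2.2.1).trans (Nat.le_add_right _ _)
  have c4 := lift (isPoly_searchE r) (fun x => [x.1.2.n ^ (2 * r * x.1.1), x.1.1, x.1.2.n]) (by
    intro x v hv
    rcases List.mem_cons.1 hv with rfl | hv
    · exact (hS x).2.2.2.1
    · exact hkn x v hv)
  -- Each of the three `letIn` adds 10, and 2 for a body of value at most 1; with the final 3 this
  -- gives 39. The multiple 8 covers twice `n`, `k`, the number of certificates and the word length.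
  refine PolyBdd.mono (((((c1.add h2 c2).add h2 c3).add h2 c4).add h2 ((K 8).mul self)).add h2
    (K 39)) fun x => ?_
  have hn : x.1.2.n ≠ 0 := x.2.2.ne'
  obtain ⟨-, s1, s2, s3, s4⟩ := hS x
  have hle := eval_searchE_le (r := r) (T := x.1.2.encode)
    [x.1.2.n ^ (2 * r * x.1.1), x.1.1, x.1.2.n]
  have hN : eval (certificateCountE r) [x.1.1, x.1.2.n] x.1.2.encode =
      x.1.2.n ^ (2 * r * x.1.1) := by simp [certificateCountE]
  simp only [listColouringE, cost_letIn, eval_letIn, eval_vertexCountE, eval_colourCountE hn, hN]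
  simp only [vertexCountE, colourCountE]
  omega

theorem machine_decides (r : ℕ) {k : ℕ} {I : ListColInstance k} (hG : IsSP2Free (r + 1) I.G) :
    DecidesWithin (StackCmd.machine (program (listColouringE r))) I
      (cost (listColouringE r) [] I.encode + 2 * I.encode.length + 3) := by
  have h := StackCmd.machine_outputs (exec_program (eval_listColouringE_le (r := r) I.encode))
  have hb : (if eval (listColouringE r) [] I.encode = 0 then none else some Γ'.blank).isSome =
      I.answer := by
    have := eval_listColouringE hG
    unfold ListColInstance.answer
    split_ifs with h0
    · simp [h0] at this; simp [this]
    · simp [this.1 h0]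
  rw [hb] at h
  exact h

end NatExpr

theorem DecidesWithin.mono {M : Turing.TM2ComputableAux Γ' Bool} {k : ℕ} {I : ListColInstance k}
    {t u : ℕ} (h : DecidesWithin M I t) (htu : t ≤ u) : DecidesWithin M I u :=
  h.map fun h => ⟨h.toEvalsTo, h.steps_le_m.trans htu⟩

theorem exists_machine (r : ℕ) : ∃ (M : Turing.TM2ComputableAux Γ' Bool) (C : ℕ),
    ∀ k : ℕ, 1 ≤ k → ∀ I : ListColInstance k, IsSP2Free (r + 1) I.G →
      DecidesWithin M I (C * (k * I.n) ^ (C * k) + C) := by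
  obtain ⟨c, hc⟩ := NatExpr.polyBdd_cost r
  set c0 := NatExpr.cost (NatExpr.listColouringE r) [] [] + 3 with hc0
  -- The summand `c0` covers graphs without vertices, whose word is empty. The others come from the
  -- `c`-th power of `sizeBound`, as `5 ^ c` in the factor and `(2 * r + 2) * c` in the exponent.
  refine ⟨_, 5 ^ c + (2 * r + 2) * c + c0, fun k hk I hG =>
    (NatExpr.machine_decides r hG).mono ?_⟩
  rcases Nat.eq_zero_or_pos I.n with hn | hn
  · have : I.encode = [] := List.eq_nil_of_length_eq_zero (by rw [I.length_encode, hn, Nat.zero_mul])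
    rw [this, List.length_nil]
    exact le_trans (b := c0) (by omega) ((Nat.le_add_left _ _).trans (Nat.le_add_left _ _))
  · refine (hc ⟨⟨k, I⟩, hk, hn⟩).trans ((Nat.le_add_right _ _).trans' ?_)
    simp only [NatExpr.sizeBound]
    rw [mul_pow, ← pow_mul]
    refine Nat.mul_le_mul (by omega) (Nat.pow_le_pow_right (Nat.mul_pos hk hn) ?_)
    have : (2 * r + 2) * k * c = (2 * r + 2) * c * k := by ring
    rw [this]
    exact Nat.mul_le_mul_right _ ((Nat.le_add_left _ _).trans (Nat.le_add_right _ _))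

/-- For fixed `k` the bound is a polynomial in `n`, and `n` is at most the length of the input word.
-/
theorem listColouringPolyTimeOnSP2Free_of_decidesWithin {k s C : ℕ}
    {M : Turing.TM2ComputableAux Γ' Bool}
    (h : ∀ I : ListColInstance k, IsSP2Free s I.G →
      DecidesWithin M I (C * (k * I.n) ^ (C * k) + C)) :
    ListColouringPolyTimeOnSP2Free k s := by
  let P : Polynomial ℕ :=
    Polynomial.C C * (Polynomial.C k * Polynomial.X) ^ (C * k) + Polynomial.C C
  have hP : ∀ I : ListColInstance k,
      C * (k * I.n) ^ (C * k) + C ≤ P.eval I.encode.length := by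
    intro I
    have hn : I.n ≤ I.encode.length := by rw [I.length_encode]; nlinarith
    simp only [P, Polynomial.eval_add, Polynomial.eval_mul, Polynomial.eval_pow,
      Polynomial.eval_C, Polynomial.eval_X]
    gcongr
  exact ⟨{ M with
    time := P
    outputsFun := fun I => Classical.choice ((h I.1 I.2).mono (hP I.1)) }⟩

theorem theorem2p4 (s : ℕ) (hs : 1 ≤ s) :
    (∀ k : ℕ, 1 ≤ k → ListColouringPolyTimeOnSP2Free k s) ∧
    ∃ (M : Turing.TM2ComputableAux Computability.Γ' Bool) (C : ℕ),
      ∀ k : ℕ, 1 ≤ k → ∀ I : ListColInstance k, IsSP2Free s I.G →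
        DecidesWithin M I (C * (k * I.n) ^ (C * k) + C) := by
  obtain ⟨r, rfl⟩ : ∃ r, s = r + 1 := ⟨s - 1, by omega⟩
  obtain ⟨M, C, h⟩ := exists_machine r
  exact ⟨fun k hk => listColouringPolyTimeOnSP2Free_of_decidesWithin (h k hk), M, C, h⟩
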